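/- **Setting.** Let $n\ge 2$, $d\ge 1$, and let $f_1,\dots,f_n:\mathbb R^d\to\mathbb R$ be differentiable with $\|\nabla f_i(x)-\nabla f_i(y)\|\le \ell\|x-y\|$ for all $x,y$ ($\ell>0$). Put $f=\frac1n\sum_i f_i$, assume $f^*=\inf f>-\infty$ and the Polyak–Łojasiewicz condition $\frac12\|\nabla f(x)\|^2\ge\nu(f(x)-f^*)$ for all $x$ ($\nu>0$). Let $A\in\mathbb R^{n\times n}$ be the symmetric nonnegative weighted adjacency matrix of a connected undirected graph on $\{1,\dots,n\}$, $L=\mathrm{diag}(\sum_jA_{ij})-A$ its Laplacian, $\rho$ the spectral radius and $\rho_2$ the smallest positive eigenvalue of $L$. Let $\mathcal C:\mathbb R^d\to\mathbb R^d$ be a locally-bounded compressor: for some $p\in[1,\infty]$, $r>0$, $C>0$, $\delta\in(0,1]$, $\|\mathcal C(x)/r-x\|_p\le C(1-\delta)$ whenever $\|x\|_p\le C$. Here $\|\cdot\|=\|\cdot\|_2$. Put $\hat d=d^{1/p-1/2}$, $\tilde d=1$ if $p\le2$, and $\hat d=1$, $\tilde d=d^{1/2-1/p}$ if $p>2$.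 **Algorithm.** Given $\alpha,\beta,\gamma,\omega>0$, positive scalars $s_k$ and $x_{i,0}\in\mathbb R^d$, start from $v_{i,0}=\hat x_{i,-1}=y_{i,-1}=0$ and for $k\ge0$ and all $i$ put $$q_{i,k}=\mathcal C\big((x_{i,k}-\hat x_{i,k-1})/s_k\big),\quad \hat x_{i,k}=\hat x_{i,k-1}+\omega s_kq_{i,k},\quad y_{i,k}=y_{i,k-1}+\omega s_k\sum_jL_{ij}q_{j,k},$$ $$x_{i,k+1}=x_{i,k}-\alpha(\beta y_{i,k}+\gamma v_{i,k}+\nabla f_i(x_{i,k})),\quad v_{i,k+1}=v_{i,k}+\alpha\gamma y_{i,k}.$$ Write $\bar x_k=\frac1n\sum_ix_{i,k}$. **Constants.** Let $\beta=\tau_1\gamma$, $\kappa_1=4/\rho_2$, $$\kappa_2=\max\Big\{2+2\ell^2,\tfrac5{\rho_2},\sqrt[3]{\tfrac{16\ell^2(\kappa_1+1)^2}{\rho_2}},\tfrac{2\sqrt2\,\ell}{\rho_2}\Big\},\qquad \kappa_2'=\max\Big\{2+3\ell^2,\tfrac5{\rho_2},\sqrt[3]{\tfrac{16\ell^2(\tau_1+1)^2}{\rho_2}},\tfrac{2\sqrt2\,\ell}{\rho_2}\Big\},$$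 $\varphi_1=\frac12(\rho_2\beta-(3\gamma+2+3\ell^2))$, $\varphi_2=3\rho^2\beta^2-\rho_2\beta\gamma+(\rho+2)\gamma^2+1+\frac52\ell^2$, $\varphi_3=\frac\gamma2-\frac5{2\rho_2}$, $\varphi_4=2\rho\gamma^2+\frac12\rho$, $\varphi_5=\frac18-\frac{(\beta+\gamma)^2\ell^2}{\gamma^5\rho_2}-\frac{\ell^2}{2\gamma^2\rho_2^2}$, $\varphi_6=\frac{(\beta+\gamma)\ell^2}{2\gamma^3\rho_2}+\frac{\ell^2}{2\gamma^2\rho_2^2}+\frac{\ell^2}{2\rho_2^2}+\frac{\ell^2}2+\frac\ell2$, $\varphi_7=(\rho+1)\gamma+\frac12\rho\beta$, $\varphi_8=3\rho^2\beta^2+(\rho-2\rho_2)\beta\gamma+(\rho+2)\gamma^2+1$; $\varepsilon_1=\frac{\tau_1\rho_2-1}{2\tau_1\rho_2}$, $\varepsilon_2=\max\{\frac{1+\tau_1\rho_2}2,\frac{1+\tau_1}2+\frac1{2\tau_1\rho_2^2}\}$, $\varepsilon_3(\alpha)=\min\{\varphi_1-\alpha\varphi_2,\varphi_3-\alpha\varphi_4\}$,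 $\varepsilon_5=\omega r(\delta-\delta^2/2)$, $\varepsilon_6(\alpha)=\min\{\nu/2,\varepsilon_3(\alpha)\}/\varepsilon_2$; $\psi_2(\alpha)=\varphi_7+\alpha\varphi_8$, $\psi_3=4(1+\varepsilon_5^{-1})\hat d^2\beta^2\rho^2$, $\psi_4=4(1+\varepsilon_5^{-1})\hat d^2\max\{\beta^2\rho^2+\ell^2,\gamma^2\rho\}/\varepsilon_1$; $\hat\kappa_0=\min\{\varphi_1/\varphi_2,\varphi_3/\varphi_4,\varphi_5/\varphi_6\}$, $\kappa_5\in(0,+\infty]$ the smallest positive root $t$ of $t\,\varepsilon_3(t)=1$ ($+\infty$ if there is none), and for $\psi_5\in\mathbb R$ $$\kappa_0'(\psi_5)=\min\Big\{\hat\kappa_0,\kappa_5,\tfrac1{\sqrt n\,\tilde d}\sqrt{\tfrac{\varepsilon_5+2\varepsilon_5^2}{(1-2\varepsilon_5)\psi_3+\psi_4\psi_5}}\Big\}.$$ Call $(\alpha,\psi_5)$ admissible if $0<\alpha<\kappa_0'(\psi_5)$ and $\psi_5>(1-2\varepsilon_5)\psi_2(\alpha)/\varepsilon_6(\alpha)$.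 Let $$\kappa_9=\sqrt{1-\alpha\big(\varepsilon_6(\alpha)-(1-2\varepsilon_5)\psi_2(\alpha)/\psi_5\big)},\quad \kappa_{10}=\sqrt{1-(\varepsilon_5+2\varepsilon_5^2)+\alpha^2n\tilde d^2\big((1-2\varepsilon_5)\psi_3+\psi_4\psi_5\big)}.$$ Let $J=\frac1n\mathbf 1\mathbf 1^\top$, $E=I_n-J$, $F=(L+\lambda J)^{-1}$ for a fixed $\lambda\in[\rho_2,\rho]$, $\boldsymbol E=E\otimes I_d$, $\boldsymbol F=F\otimes I_d$, $\boldsymbol x_0=\mathrm{col}(x_{1,0},\dots,x_{n,0})$, $\boldsymbol w=\frac1\gamma\mathrm{col}(\nabla f_1(\bar x_0),\dots,\nabla f_n(\bar x_0))$ and $$\kappa_\nu=\tfrac12\boldsymbol x_0^\top\boldsymbol E\boldsymbol x_0+\tfrac{\beta+\gamma}{2\gamma}\boldsymbol w^\top\boldsymbol F\boldsymbol w+\boldsymbol x_0^\top\boldsymbol E\boldsymbol F\boldsymbol w+\tfrac n{2\nu}\|\nabla f(\bar x_0)\|^2 .$$ **Theorem.** Let $\tau_1>\kappa_1$, $\gamma>\kappa_2$,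 $\beta=\tau_1\gamma$ and $\omega\in(0,1/r]$. 1. If $\gamma>\kappa_2'$, then there are $\psi_5$ and $\bar\alpha>0$ such that $(\alpha,\psi_5)$ is admissible for every $\alpha\in(0,\bar\alpha)$. 2. Let $(\alpha,\psi_5)$ be admissible. Then $\max\{\kappa_9,\kappa_{10}\}<1$. Moreover, for every $\epsilon\in(\max\{\kappa_9,\kappa_{10}\},1)$, all initial points $x_{i,0}$, every $\lambda\in[\rho_2,\rho]$ and every $s_0>0$ with $$s_0\ge\max\Big\{\sqrt{\tfrac{\kappa_\nu}{n\tilde d^2\psi_5C^2}},\ \tfrac{\max_i\|x_{i,0}\|_p}{C}\Big\},$$ the algorithm run with $s_k=s_0\epsilon^k$ satisfies $$f(\bar x_k)-f^*+\frac1n\sum_{i=1}^n\|x_{i,k}-\bar x_k\|^2=\mathcal O(\epsilon^{2k})\qquad(k\to\infty).$$ -/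

import Mathlib

open scoped ENNReal

noncomputable section

namespace UnifiedCompression

/-- The decision space `ℝ^d` with its Euclidean norm. -/
abbrev Vec (d : ℕ) : Type := EuclideanSpace ℝ (Fin d)

/-- The `ℓ_p` norm on `ℝ^d`, for `1 ≤ p ≤ ∞`. -/
def lpNorm {d : ℕ} (p : ℝ≥0∞) (x : Vec d) : ℝ := ‖WithLp.toLp p (WithLp.ofLp x)‖

/-- All the data of the problem and the fixed gains of the algorithm. This is plain data;
the assumptions on it are the separate predicates below. -/
structure Setting (n d : ℕ) where
  /-- weighted adjacency matrix of the communication graph -/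
  A : Matrix (Fin n) (Fin n) ℝ
  /-- local cost functions -/
  f : Fin n → Vec d → ℝ
  /-- the compressor -/
  comp : Vec d → Vec d
  /-- exponent of the norm in the compressor bound -/
  p : ℝ≥0∞
  /-- scaling of the compressor -/
  r : ℝ
  /-- radius of the local region -/
  C : ℝ
  /-- contraction of the compressor -/
  δ : ℝ
  /-- smoothness constant of the local costs -/
  ℓ : ℝ
  /-- Polyak–Łojasiewicz constant -/
  ν : ℝ
  /-- ratio `β / γ` -/
  τ₁ : ℝ
  γ : ℝ
  ω : ℝ

namespace Setting

variable {n d : ℕ} (S : Setting n d)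

/-! ### Assumptions -/

/-- Locally-bounded compressor. -/
structure LocallyBounded : Prop where
  one_le_p : 1 ≤ S.p
  r_pos : 0 < S.r
  C_pos : 0 < S.C
  δ_pos : 0 < S.δ
  δ_le : S.δ ≤ 1
  bound : ∀ x : Vec d, lpNorm S.p x ≤ S.C →
    lpNorm S.p (S.r⁻¹ • S.comp x - x) ≤ S.C * (1 - S.δ)

/-- The weighted graph is undirected and connected. -/
structure UndirectedConnected : Prop where
  nonneg : ∀ i j, 0 ≤ S.A i j
  symm : ∀ i j, S.A i j = S.A j i
  connected : (SimpleGraph.fromRel fun i j => 0 < S.A i j).Connected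

/-- Every local cost is differentiable with `ℓ`-Lipschitz gradient. -/
structure Smooth : Prop where
  ℓ_pos : 0 < S.ℓ
  differentiable : ∀ i, Differentiable ℝ (S.f i)
  lipschitz : ∀ i x y, ‖gradient (S.f i) x - gradient (S.f i) y‖ ≤ S.ℓ * ‖x - y‖

/-- The global cost `f = (1/n) ∑ f_i`. -/
def F (x : Vec d) : ℝ := (1 / (n : ℝ)) * ∑ i, S.f i x

/-- The optimal value is finite. -/
def FiniteOptimum : Prop := BddBelow (Set.range S.F)

/-- The optimal value `f* = inf f`. -/
def fStar : ℝ := ⨅ x, S.F x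

/-- Polyak–Łojasiewicz condition with constant `ν`. -/
structure PolyakLojasiewicz : Prop where
  ν_pos : 0 < S.ν
  bound : ∀ x, (1 / 2 : ℝ) * ‖gradient S.F x‖ ^ 2 ≥ S.ν * (S.F x - S.fStar)

/-! ### The algorithm -/

/-- Graph Laplacian `L = D - A`. -/
def L : Matrix (Fin n) (Fin n) ℝ := Matrix.diagonal (fun i => ∑ j, S.A i j) - S.A

def β : ℝ := S.τ₁ * S.γ

/-- State before iteration `k`: `x = x_k`, `v = v_k`, `xhat = x̂_{k-1}`, `y = y_{k-1}`. -/
structure State (n d : ℕ) where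
  x : Fin n → Vec d
  v : Fin n → Vec d
  xhat : Fin n → Vec d
  y : Fin n → Vec d

/-- One iteration with stepsize `α` and scaling factor `s = s_k`. -/
def step (α s : ℝ) (z : State n d) : State n d :=
  let q : Fin n → Vec d := fun i => S.comp (s⁻¹ • (z.x i - z.xhat i))
  let y : Fin n → Vec d := fun i => z.y i + (S.ω * s) • ∑ j, S.L i j • q j
  { x := fun i => z.x i - α • (S.β • y i + S.γ • z.v i + gradient (S.f i) (z.x i))
    v := fun i => z.v i + (α * S.γ) • y i
    xhat := fun i => z.xhat i + (S.ω * s) • q i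
    y := y }

/-- The run of the algorithm with stepsize `α`, scaling sequence `s`, initial points `x₀`. -/
def run (α : ℝ) (s : ℕ → ℝ) (x₀ : Fin n → Vec d) : ℕ → State n d
  | 0 => { x := x₀, v := 0, xhat := 0, y := 0 }
  | k + 1 => S.step α (s k) (run α s x₀ k)

/-- Average of the agents' points. -/
def avg (x : Fin n → Vec d) : Vec d := (1 / (n : ℝ)) • ∑ i, x i

/-- `f(x̄) - f* + (1/n) ∑ ‖x_i - x̄‖²`. -/
def gap (x : Fin n → Vec d) : ℝ :=
  S.F (avg x) - S.fStar + (1 / (n : ℝ)) * ∑ i, ‖x i - avg x‖ ^ 2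

/-! ### Constants -/

/-- Spectral radius of the Laplacian. -/
def ρ : ℝ := (spectralRadius ℝ S.L).toReal

/-- Smallest positive eigenvalue of the Laplacian. -/
def ρ₂ : ℝ := sInf {μ : ℝ | μ ∈ spectrum ℝ S.L ∧ 0 < μ}

/-- `‖x‖_p ≤ dHat * ‖x‖`; here `1 / ∞ = 0`. -/
def dHat : ℝ := if S.p ≤ 2 then (d : ℝ) ^ (1 / S.p.toReal - 1 / 2) else 1

/-- `‖x‖ ≤ dTilde * ‖x‖_p`; here `1 / ∞ = 0`. -/
def dTilde : ℝ := if S.p ≤ 2 then 1 else (d : ℝ) ^ (1 / 2 - 1 / S.p.toReal)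

def κ₁ : ℝ := 4 / S.ρ₂

def κ₂ : ℝ :=
  max (max (2 + 2 * S.ℓ ^ 2) (5 / S.ρ₂))
    (max ((16 * S.ℓ ^ 2 * (S.κ₁ + 1) ^ 2 / S.ρ₂) ^ (1 / 3 : ℝ)) (2 * √2 * S.ℓ / S.ρ₂))

/-- The threshold on `γ` above which the stepsize range is certainly nonempty. -/
def κ₂' : ℝ :=
  max (max (2 + 3 * S.ℓ ^ 2) (5 / S.ρ₂))
    (max ((16 * S.ℓ ^ 2 * (S.τ₁ + 1) ^ 2 / S.ρ₂) ^ (1 / 3 : ℝ)) (2 * √2 * S.ℓ / S.ρ₂))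

def φ₁ : ℝ := (1 / 2) * (S.ρ₂ * S.β - (3 * S.γ + 2 + 3 * S.ℓ ^ 2))

def φ₂ : ℝ :=
  3 * S.ρ ^ 2 * S.β ^ 2 - S.ρ₂ * S.β * S.γ + (S.ρ + 2) * S.γ ^ 2 + 1 + 5 / 2 * S.ℓ ^ 2

def φ₃ : ℝ := S.γ / 2 - 5 / 2 * S.ρ₂⁻¹

def φ₄ : ℝ := 2 * S.ρ * S.γ ^ 2 + 1 / 2 * S.ρ

def φ₅ : ℝ :=
  1 / 8 - (S.β + S.γ) ^ 2 / S.γ ^ 5 * S.ρ₂⁻¹ * S.ℓ ^ 2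
    - 1 / (2 * S.γ ^ 2) * (S.ρ₂⁻¹) ^ 2 * S.ℓ ^ 2

def φ₆ : ℝ :=
  (S.β + S.γ) / (2 * S.γ ^ 3) * S.ρ₂⁻¹ * S.ℓ ^ 2
    + 1 / (2 * S.γ ^ 2) * (S.ρ₂⁻¹) ^ 2 * S.ℓ ^ 2
    + (S.ρ₂⁻¹) ^ 2 / 2 * S.ℓ ^ 2 + S.ℓ ^ 2 / 2 + S.ℓ / 2

def φ₇ : ℝ := (S.ρ + 1) * S.γ + 1 / 2 * S.ρ * S.β

def φ₈ : ℝ :=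
  3 * S.ρ ^ 2 * S.β ^ 2 + (S.ρ - 2 * S.ρ₂) * S.β * S.γ + (S.ρ + 2) * S.γ ^ 2 + 1

def ε₁ : ℝ := (S.τ₁ * S.ρ₂ - 1) / (2 * S.τ₁ * S.ρ₂)

def ε₂ : ℝ :=
  max ((1 + S.τ₁ * S.ρ₂) / 2) ((1 + S.τ₁) / 2 + 1 / (2 * S.τ₁ * S.ρ₂ ^ 2))

def ε₃ (α : ℝ) : ℝ := min (S.φ₁ - α * S.φ₂) (S.φ₃ - α * S.φ₄)

def ε₅ : ℝ := S.ω * S.r * (S.δ - S.δ ^ 2 / 2)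

def ε₆ (α : ℝ) : ℝ := min (S.ν / 2) (S.ε₃ α) / S.ε₂

def ψ₂ (α : ℝ) : ℝ := S.φ₇ + α * S.φ₈

def ψ₃ : ℝ := 4 * (1 + S.ε₅⁻¹) * S.dHat ^ 2 * S.β ^ 2 * S.ρ ^ 2

def ψ₄ : ℝ :=
  4 * (1 + S.ε₅⁻¹) * S.dHat ^ 2
    * max (S.β ^ 2 * S.ρ ^ 2 + S.ℓ ^ 2) (S.γ ^ 2 * S.ρ) / S.ε₁

/-- Lower bound that `ψ₅` has to exceed, for the stepsize `α`. -/
def ψ₅Low (α : ℝ) : ℝ := (1 - 2 * S.ε₅) * S.ψ₂ α / S.ε₆ α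

def κHat₀ : ℝ := min (S.φ₁ / S.φ₂) (min (S.φ₃ / S.φ₄) (S.φ₅ / S.φ₆))

/-- The smallest positive root of `t * ε₃ t = 1`, and `+∞` if there is none. -/
def κ₅ : EReal := sInf {t : EReal | ∃ a : ℝ, 0 < a ∧ a * S.ε₃ a = 1 ∧ t = (a : EReal)}

def κ₆' (ψ₅ : ℝ) : ℝ :=
  √((S.ε₅ + 2 * S.ε₅ ^ 2) / ((1 - 2 * S.ε₅) * S.ψ₃ + S.ψ₄ * ψ₅))

/-- Upper bound for the stepsize. -/
def κ₀' (ψ₅ : ℝ) : EReal :=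
  min (S.κHat₀ : EReal) (min S.κ₅ ((S.κ₆' ψ₅ / (√(n : ℝ) * S.dTilde) : ℝ) : EReal))

/-- `α` lies in `(0, κ₀')` and `ψ₅` exceeds its lower bound. -/
def Admissible (α ψ₅ : ℝ) : Prop :=
  0 < α ∧ (α : EReal) < S.κ₀' ψ₅ ∧ S.ψ₅Low α < ψ₅

def κ₉ (α ψ₅ : ℝ) : ℝ :=
  √(1 - α * (S.ε₆ α - (1 - 2 * S.ε₅) * S.ψ₂ α * (1 / ψ₅)))

def κ₁₀ (α ψ₅ : ℝ) : ℝ :=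
  √(1 - (S.ε₅ + 2 * S.ε₅ ^ 2)
    + α ^ 2 * n * S.dTilde ^ 2 * ((1 - 2 * S.ε₅) * S.ψ₃ + S.ψ₄ * ψ₅))

/-- The averaging matrix `(1/n) 1 1ᵀ`. -/
def avgMat (n : ℕ) : Matrix (Fin n) (Fin n) ℝ := Matrix.of fun _ _ => 1 / (n : ℝ)

/-- `E = I - (1/n) 1 1ᵀ`. -/
def centerMat (n : ℕ) : Matrix (Fin n) (Fin n) ℝ := 1 - avgMat n

/-- With `L = [q Q] diag(0, Λ) [q Q]ᵀ` and `q = 1/√n`, this is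
`[q Q] diag(lam⁻¹, Λ⁻¹) [q Q]ᵀ = (L + lam q qᵀ)⁻¹`. -/
def dualMat (lam : ℝ) : Matrix (Fin n) (Fin n) ℝ := (S.L + lam • avgMat n)⁻¹

/-- `uᵀ (M ⊗ I_d) w` for stacked vectors `u`, `w`. -/
def stackedForm (M : Matrix (Fin n) (Fin n) ℝ) (u w : Fin n → Vec d) : ℝ :=
  ∑ i, ∑ j, M i j * inner ℝ (u i) (w j)

/-- The computable bound for the initial Lyapunov value; note `v_{i,0} = 0`. -/
def κν (lam : ℝ) (x₀ : Fin n → Vec d) : ℝ :=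
  let w : Fin n → Vec d := fun i => S.γ⁻¹ • gradient (S.f i) (avg x₀)
  1 / 2 * stackedForm (centerMat n) x₀ x₀
    + 1 / 2 * ((S.β + S.γ) / S.γ * stackedForm (S.dualMat lam) w w)
    + stackedForm (centerMat n * S.dualMat lam) x₀ w
    + 1 / (2 * S.ν) * (n * ‖gradient S.F (avg x₀)‖ ^ 2)

end Setting

end UnifiedCompression

end

/-!
Centering splits the stacked iterate into a consensus part, a dual variable `v + ∇f(x̄) / γ` with
its average removed, and the mean `x̄`. A quadratic form in the first two parts plus the
optimality gap at `x̄` is a Lyapunov function: one step contracts it, with the squared compression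
error `‖x - x̂‖²` as an additive input. That error is controlled only while every compressor input
`x - x̂` stays in a region of radius `C * s`. With `s = s₀ * ε ^ k` the two bounds sustain
each other: if the inputs lie in the region and the Lyapunov function is of order `s²`, then the
same holds after one step at scale `ε * s`, the Lyapunov function because `κ₉ < ε` and the inputs
because `κ₁₀ < ε`.
-/

open scoped ENNReal InnerProductSpace

noncomputable section

/-! ### Comparison of norms -/

namespace UnifiedCompression

section PiLpComparison

variable {ι : Type*} [Fintype ι] {β : ι → Type*} [∀ i, SeminormedAddCommGroup (β i)]
  {p q : ℝ≥0∞}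

lemma norm_toLp_anti [Fact (1 ≤ p)] (hpq : p ≤ q) (x : ∀ i, β i) :
    ‖WithLp.toLp q x‖ ≤ ‖WithLp.toLp p x‖ := by
  have hcoord (i : ι) : ‖x i‖ ≤ ‖WithLp.toLp p x‖ := PiLp.norm_apply_le (WithLp.toLp p x) i
  obtain rfl | hq := eq_or_ne q ∞
  · rw [PiLp.norm_eq_ciSup]
    exact Real.iSup_le hcoord (norm_nonneg _)
  have hp := (hpq.trans_lt hq.lt_top).ne
  have hp_pos : 0 < p.toReal := ENNReal.toReal_pos (one_pos.trans_le Fact.out).ne' hp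
  have hpq' : p.toReal ≤ q.toReal := ENNReal.toReal_mono hq hpq
  have hq_pos := hp_pos.trans_le hpq'
  have hsplit {t : ℝ} (ht : 0 ≤ t) : t ^ q.toReal = t ^ p.toReal * t ^ (q.toReal - p.toReal) := by
    rw [← Real.rpow_add_of_nonneg ht hp_pos.le (sub_nonneg.2 hpq'), add_sub_cancel]
  rw [PiLp.norm_eq_sum hq_pos, one_div, Real.rpow_inv_le_iff_of_pos (by positivity) (norm_nonneg _)
    hq_pos]
  calc ∑ i, ‖x i‖ ^ q.toReal
      ≤ ∑ i, ‖x i‖ ^ p.toReal * ‖WithLp.toLp p x‖ ^ (q.toReal - p.toReal) := by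
        gcongr with i
        rw [hsplit (norm_nonneg _)]
        gcongr
        exact hcoord i
    _ = ‖WithLp.toLp p x‖ ^ q.toReal := by
        rw [← Finset.sum_mul, hsplit (norm_nonneg _), PiLp.norm_eq_sum hp_pos, one_div,
          Real.rpow_inv_rpow (by positivity) hp_pos.ne']

/-- Here `1 / ∞ = 0`, because `ENNReal.toReal ∞ = 0`. -/
lemma norm_toLp_le_card_rpow_mul [Fact (1 ≤ p)] [Fact (1 ≤ q)] (hpq : p ≤ q) (x : ∀ i, β i) :
    ‖WithLp.toLp p x‖ ≤
      (Fintype.card ι : ℝ) ^ (1 / p.toReal - 1 / q.toReal) * ‖WithLp.toLp q x‖ := by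
  obtain rfl | hp := eq_or_ne p ∞
  · obtain rfl := top_le_iff.1 hpq
    simp
  have hp_pos : 0 < p.toReal := ENNReal.toReal_pos (one_pos.trans_le Fact.out).ne' hp
  rw [PiLp.norm_eq_sum hp_pos, one_div, Real.rpow_inv_le_iff_of_pos (by positivity) (by positivity)
    hp_pos, Real.mul_rpow (by positivity) (norm_nonneg _), ← Real.rpow_mul (Nat.cast_nonneg _),
    sub_mul, inv_mul_cancel₀ hp_pos.ne']
  obtain rfl | hq := eq_or_ne q ∞
  · calc ∑ i, ‖x i‖ ^ p.toReal ≤ ∑ _i : ι, ‖WithLp.toLp ∞ x‖ ^ p.toReal := by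
          gcongr with i
          exact PiLp.norm_apply_le (WithLp.toLp ∞ x) i
      _ = _ := by simp
  have hpq' : p.toReal ≤ q.toReal := ENNReal.toReal_mono hq hpq
  have hq_pos := hp_pos.trans_le hpq'
  have hmean := Real.rpow_sum_le_const_mul_sum_rpow_of_nonneg Finset.univ
    (f := fun i => ‖x i‖ ^ p.toReal) ((one_le_div hp_pos).2 hpq') fun i _ => by positivity
  simp only [← Real.rpow_mul (norm_nonneg _), mul_div_cancel₀ _ hp_pos.ne', Finset.card_univ]
    at hmean
  have hpow := Real.rpow_le_rpow (by positivity) hmean (by positivity : 0 ≤ p.toReal / q.toReal)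
  rw [← Real.rpow_mul (by positivity), Real.mul_rpow (by positivity) (by positivity),
    ← Real.rpow_mul (by positivity)] at hpow
  rw [PiLp.norm_eq_sum hq_pos, ← Real.rpow_mul (by positivity)]
  convert hpow using 2
  · rw [div_mul_div_cancel₀ hp_pos.ne', div_self hq_pos.ne', Real.rpow_one]
  · congr 1
    field_simp
  · congr 1
    field_simp

end PiLpComparison

section LpNorm

variable {d : ℕ} {p : ℝ≥0∞} [Fact (1 ≤ p)]

lemma lpNorm_nonneg (x : Vec d) : 0 ≤ lpNorm p x :=
  norm_nonneg (WithLp.toLp p (WithLp.ofLp x))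

lemma lpNorm_add_le (x y : Vec d) : lpNorm p (x + y) ≤ lpNorm p x + lpNorm p y :=
  norm_add_le (WithLp.toLp p (WithLp.ofLp x)) (WithLp.toLp p (WithLp.ofLp y))

lemma lpNorm_smul (c : ℝ) (x : Vec d) : lpNorm p (c • x) = |c| * lpNorm p x :=
  norm_smul c (WithLp.toLp p (WithLp.ofLp x))

end LpNorm

namespace Setting

variable {n d : ℕ} (S : Setting n d)

lemma lpNorm_le_dHat_mul [Fact (1 ≤ S.p)] (x : Vec d) : lpNorm S.p x ≤ S.dHat * ‖x‖ := by
  unfold dHat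
  split_ifs with hp
  · simpa [lpNorm] using norm_toLp_le_card_rpow_mul hp (WithLp.ofLp x)
  · simpa [lpNorm] using norm_toLp_anti (le_of_not_ge hp) (WithLp.ofLp x)

lemma norm_le_dTilde_mul [Fact (1 ≤ S.p)] (x : Vec d) : ‖x‖ ≤ S.dTilde * lpNorm S.p x := by
  unfold dTilde
  split_ifs with hp
  · simpa [lpNorm] using norm_toLp_anti hp (WithLp.ofLp x)
  · simpa [lpNorm] using norm_toLp_le_card_rpow_mul (le_of_not_ge hp) (WithLp.ofLp x)

lemma dHat_pos (hd : 1 ≤ d) : 0 < S.dHat := by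
  have : (0 : ℝ) < d := by exact_mod_cast hd
  unfold dHat
  split_ifs <;> positivity

lemma dTilde_pos (hd : 1 ≤ d) : 0 < S.dTilde := by
  have : (0 : ℝ) < d := by exact_mod_cast hd
  unfold dTilde
  split_ifs <;> positivity

end Setting

end UnifiedCompression

/-! ### Spectrum of the Laplacian -/

namespace UnifiedCompression

open Matrix

variable {ι : Type*} [Fintype ι] [DecidableEq ι] {M : Matrix ι ι ℝ}

lemma abs_le_toReal_spectralRadius {μ : ℝ} (hμ : μ ∈ spectrum ℝ M) :
    |μ| ≤ (spectralRadius ℝ M).toReal := by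
  obtain ⟨B, hB⟩ := (M.finite_real_spectrum.image fun k => ‖k‖₊).bddAbove
  have hfin : spectralRadius ℝ M ≠ ∞ := ne_top_of_le_ne_top ENNReal.coe_ne_top <|
    iSup₂_le fun k hk => ENNReal.coe_le_coe.2 (hB (Set.mem_image_of_mem _ hk))
  exact ENNReal.toReal_mono hfin
    (le_iSup₂ (f := fun k (_ : k ∈ spectrum ℝ M) => (‖k‖₊ : ℝ≥0∞)) μ hμ)

lemma dotProduct_eq_sum_eigenvectorBasis (hM : M.IsHermitian) (a b : ι → ℝ) :
    a ⬝ᵥ b = ∑ i, (a ⬝ᵥ (hM.eigenvectorBasis i).ofLp) * (b ⬝ᵥ (hM.eigenvectorBasis i).ofLp) := by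
  have h := hM.eigenvectorBasis.sum_inner_mul_inner (WithLp.toLp 2 a) (WithLp.toLp 2 b)
  simp only [EuclideanSpace.inner_eq_star_dotProduct, star_trivial] at h
  rw [dotProduct_comm, ← h]
  exact Finset.sum_congr rfl fun i _ => by rw [dotProduct_comm a]

lemma mulVec_dotProduct_eigenvectorBasis (hM : M.IsHermitian) (a : ι → ℝ) (i : ι) :
    (M *ᵥ a) ⬝ᵥ (hM.eigenvectorBasis i).ofLp =
      hM.eigenvalues i * (a ⬝ᵥ (hM.eigenvectorBasis i).ofLp) := by
  have hM' : Mᵀ = M := hM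
  rw [dotProduct_comm, dotProduct_mulVec, ← mulVec_transpose, hM', hM.mulVec_eigenvectorBasis,
    smul_dotProduct, smul_eq_mul, dotProduct_comm]

lemma mulVec_dotProduct_mulVec_le (hM : M.PosSemidef) (a : ι → ℝ) :
    (M *ᵥ a) ⬝ᵥ (M *ᵥ a) ≤ (spectralRadius ℝ M).toReal * (a ⬝ᵥ M *ᵥ a) := by
  rw [dotProduct_eq_sum_eigenvectorBasis hM.1, dotProduct_eq_sum_eigenvectorBasis hM.1 a,
    Finset.mul_sum]
  refine Finset.sum_le_sum fun i _ => ?_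
  rw [mulVec_dotProduct_eigenvectorBasis]
  have hle := (le_abs_self _).trans
    (abs_le_toReal_spectralRadius (hM.1.eigenvalues_mem_spectrum_real i))
  nlinarith [mul_nonneg (mul_nonneg (hM.eigenvalues_nonneg i) (sub_nonneg.2 hle))
    (sq_nonneg (a ⬝ᵥ (hM.1.eigenvectorBasis i).ofLp))]

lemma sInf_pos_spectrum_mul_dotProduct_le (hM : M.PosSemidef) {a : ι → ℝ}
    (ha : ∀ b, M *ᵥ b = 0 → a ⬝ᵥ b = 0) :
    sInf {μ : ℝ | μ ∈ spectrum ℝ M ∧ 0 < μ} * (a ⬝ᵥ a) ≤ a ⬝ᵥ M *ᵥ a := by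
  rw [dotProduct_eq_sum_eigenvectorBasis hM.1, dotProduct_eq_sum_eigenvectorBasis hM.1 a (M *ᵥ a),
    Finset.mul_sum]
  refine Finset.sum_le_sum fun i _ => ?_
  rw [mulVec_dotProduct_eigenvectorBasis]
  rcases (hM.eigenvalues_nonneg i).eq_or_lt with hzero | hpos
  · simp [ha _ (by rw [hM.1.mulVec_eigenvectorBasis, ← hzero, zero_smul])]
  · have hle : sInf {μ : ℝ | μ ∈ spectrum ℝ M ∧ 0 < μ} ≤ hM.1.eigenvalues i :=
      csInf_le ⟨0, fun _ h => h.2.le⟩ ⟨hM.1.eigenvalues_mem_spectrum_real i, hpos⟩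
    nlinarith [mul_nonneg (sub_nonneg.2 hle) (sq_nonneg (a ⬝ᵥ (hM.1.eigenvectorBasis i).ofLp))]

lemma sInf_pos_spectrum_mem (hM : M.PosSemidef) (hne : M ≠ 0) :
    sInf {μ : ℝ | μ ∈ spectrum ℝ M ∧ 0 < μ} ∈ {μ : ℝ | μ ∈ spectrum ℝ M ∧ 0 < μ} := by
  obtain ⟨i, hi⟩ := Function.ne_iff.1 (mt hM.1.eigenvalues_eq_zero_iff.1 hne)
  exact Set.Nonempty.csInf_mem ⟨_, hM.1.eigenvalues_mem_spectrum_real i,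
    (hM.eigenvalues_nonneg i).lt_of_ne' hi⟩ (M.finite_real_spectrum.subset fun _ h => h.1)

end UnifiedCompression

namespace UnifiedCompression.Setting

open Matrix

variable {n d : ℕ} {S : Setting n d}

section Laplacian

lemma L_mulVec_apply (a : Fin n → ℝ) (i : Fin n) :
    (S.L *ᵥ a) i = ∑ j, S.A i j * (a i - a j) := by
  simp only [L, sub_mulVec, Pi.sub_apply, mulVec_diagonal, mul_sub, Finset.sum_sub_distrib,
    Finset.sum_mul]
  rfl

lemma L_transpose (hgraph : S.UndirectedConnected) : S.Lᵀ = S.L := by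
  have hA : S.Aᵀ = S.A := by ext i j; exact hgraph.symm j i
  simp [L, hA]

lemma dotProduct_L_mulVec (hgraph : S.UndirectedConnected) (a : Fin n → ℝ) :
    a ⬝ᵥ S.L *ᵥ a = 1 / 2 * ∑ i, ∑ j, S.A i j * (a i - a j) ^ 2 := by
  have hrow : a ⬝ᵥ S.L *ᵥ a = ∑ i, ∑ j, S.A i j * (a i * (a i - a j)) := by
    simp only [dotProduct, L_mulVec_apply, Finset.mul_sum, mul_left_comm]
  have hcol : a ⬝ᵥ S.L *ᵥ a = ∑ i, ∑ j, S.A i j * (a j * (a j - a i)) := by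
    rw [hrow, Finset.sum_comm]
    simp only [hgraph.symm]
  have hsq : ∑ i, ∑ j, S.A i j * (a i - a j) ^ 2 = a ⬝ᵥ S.L *ᵥ a + a ⬝ᵥ S.L *ᵥ a := by
    nth_rw 1 [hrow, hcol]
    simp only [← Finset.sum_add_distrib]
    congr! 2
    ring
  rw [hsq]
  ring

lemma L_posSemidef (hgraph : S.UndirectedConnected) : S.L.PosSemidef := by
  refine .of_dotProduct_mulVec_nonneg (L_transpose hgraph) fun a => ?_
  rw [star_trivial, dotProduct_L_mulVec hgraph]
  exact mul_nonneg one_half_pos.le <| Finset.sum_nonneg fun i _ => Finset.sum_nonneg fun j _ =>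
    mul_nonneg (hgraph.nonneg i j) (sq_nonneg _)

lemma eq_of_L_mulVec_eq_zero (hgraph : S.UndirectedConnected) {a : Fin n → ℝ}
    (ha : S.L *ᵥ a = 0) (i j : Fin n) : a i = a j := by
  have hnonneg (i j : Fin n) : 0 ≤ S.A i j * (a i - a j) ^ 2 :=
    mul_nonneg (hgraph.nonneg i j) (sq_nonneg _)
  have hsum : ∑ i, ∑ j, S.A i j * (a i - a j) ^ 2 = 0 := by
    simpa [ha] using (dotProduct_L_mulVec hgraph a).symm
  have hedge {i j : Fin n} (hij : 0 < S.A i j) : a i = a j := by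
    have hrow := (Fintype.sum_eq_zero_iff_of_nonneg
      fun i => Fintype.sum_nonneg (hnonneg i)).1 hsum
    have hterm := congrFun ((Fintype.sum_eq_zero_iff_of_nonneg (hnonneg i)).1 (congrFun hrow i)) j
    exact sub_eq_zero.1 (pow_eq_zero_iff two_ne_zero |>.1
      ((mul_eq_zero.1 hterm).resolve_left hij.ne'))
  obtain ⟨walk⟩ := hgraph.connected.preconnected i j
  induction walk with
  | nil => rfl
  | cons hadj _ ih =>
    rw [SimpleGraph.fromRel_adj] at hadj
    exact (hadj.2.elim hedge fun h => (hedge h).symm).trans ih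

lemma L_ne_zero (hn : 2 ≤ n) (hgraph : S.UndirectedConnected) : S.L ≠ 0 := fun hzero => by
  have : Nontrivial (Fin n) := Fin.nontrivial_iff_two_le.2 hn
  obtain ⟨i, j, hij⟩ := exists_pair_ne (Fin n)
  have h := eq_of_L_mulVec_eq_zero hgraph (a := Pi.single i 1) (by rw [hzero, zero_mulVec]) i j
  simp [hij.symm] at h

lemma ρ₂_pos (hn : 2 ≤ n) (hgraph : S.UndirectedConnected) : 0 < S.ρ₂ :=
  (sInf_pos_spectrum_mem (L_posSemidef hgraph) (L_ne_zero hn hgraph)).2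

lemma ρ₂_le_ρ (hn : 2 ≤ n) (hgraph : S.UndirectedConnected) : S.ρ₂ ≤ S.ρ :=
  (le_abs_self _).trans <| abs_le_toReal_spectralRadius
    (sInf_pos_spectrum_mem (L_posSemidef hgraph) (L_ne_zero hn hgraph)).1

lemma ρ₂_mul_dotProduct_le (hgraph : S.UndirectedConnected) {a : Fin n → ℝ}
    (ha : ∑ i, a i = 0) : S.ρ₂ * (a ⬝ᵥ a) ≤ a ⬝ᵥ S.L *ᵥ a := by
  refine sInf_pos_spectrum_mul_dotProduct_le (L_posSemidef hgraph) fun b hb => ?_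
  obtain ⟨i₀⟩ := hgraph.connected.nonempty
  simp only [dotProduct, eq_of_L_mulVec_eq_zero hgraph hb _ i₀, ← Finset.sum_mul, ha, zero_mul]

end Laplacian

section DualMatrix

lemma avgMat_transpose : (avgMat n)ᵀ = avgMat n := rfl

lemma avgMat_mul_avgMat : avgMat n * avgMat n = avgMat n := by
  ext i j
  have : (n : ℝ) ≠ 0 := by exact_mod_cast i.pos.ne'
  simp [Matrix.mul_apply, avgMat, this]

lemma avgMat_mulVec (a : Fin n → ℝ) : avgMat n *ᵥ a = fun _ => 1 / (n : ℝ) * ∑ i, a i := by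
  ext i
  simp [avgMat, mulVec, dotProduct, Finset.mul_sum]

lemma L_mul_avgMat : S.L * avgMat n = 0 := by
  ext i j
  simpa [mulVec, dotProduct, Matrix.mul_apply, avgMat] using
    L_mulVec_apply (S := S) (fun _ => 1 / (n : ℝ)) i

lemma avgMat_mul_L (hgraph : S.UndirectedConnected) : avgMat n * S.L = 0 := by
  simpa [avgMat_transpose, L_transpose hgraph] using congrArg transpose (L_mul_avgMat (S := S))

lemma centerMat_mul_L (hgraph : S.UndirectedConnected) : centerMat n * S.L = S.L := by
  rw [centerMat, sub_mul, one_mul, avgMat_mul_L hgraph, sub_zero]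

lemma centerMat_transpose : (centerMat n)ᵀ = centerMat n := by
  simp [centerMat, avgMat_transpose]

lemma isUnit_L_add_smul_avgMat (hgraph : S.UndirectedConnected) {lam : ℝ} (hlam : 0 < lam) :
    IsUnit (S.L + lam • avgMat n) := by
  rw [← mulVec_injective_iff_isUnit]
  refine (injective_iff_map_eq_zero (S.L + lam • avgMat n).mulVecLin).2 fun a ha => ?_
  rw [mulVecLin_apply, add_mulVec, smul_mulVec] at ha
  have havg : avgMat n *ᵥ a = 0 := by
    have h := congrArg (avgMat n *ᵥ ·) ha
    simp only [mulVec_add, mulVec_mulVec, mulVec_smul, avgMat_mul_L hgraph, zero_mulVec, zero_add,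
      avgMat_mul_avgMat, mulVec_zero] at h
    exact (smul_eq_zero.1 h).resolve_left hlam.ne'
  rw [havg, smul_zero, add_zero] at ha
  ext i
  have : (n : ℝ) ≠ 0 := by exact_mod_cast i.pos.ne'
  simpa [avgMat_mulVec, eq_of_L_mulVec_eq_zero hgraph ha _ i, this] using congrFun havg i

lemma dualMat_transpose (hgraph : S.UndirectedConnected) (lam : ℝ) :
    (S.dualMat lam)ᵀ = S.dualMat lam := by
  simp [dualMat, transpose_nonsing_inv, L_transpose hgraph, avgMat_transpose]

lemma L_add_smul_avgMat_mul_dualMat (hgraph : S.UndirectedConnected) {lam : ℝ} (hlam : 0 < lam) :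
    (S.L + lam • avgMat n) * S.dualMat lam = 1 :=
  mul_nonsing_inv _ <| (isUnit_iff_isUnit_det _).1 (isUnit_L_add_smul_avgMat hgraph hlam)

lemma smul_avgMat_mul_dualMat (hgraph : S.UndirectedConnected) {lam : ℝ} (hlam : 0 < lam) :
    lam • (avgMat n * S.dualMat lam) = avgMat n := by
  simpa [← mul_assoc, mul_add, avgMat_mul_L hgraph, avgMat_mul_avgMat] using
    congrArg (avgMat n * ·) (L_add_smul_avgMat_mul_dualMat hgraph hlam)

lemma L_mul_dualMat (hgraph : S.UndirectedConnected) {lam : ℝ} (hlam : 0 < lam) :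
    S.L * S.dualMat lam = centerMat n := by
  have hinv := L_add_smul_avgMat_mul_dualMat hgraph hlam
  rw [add_mul, smul_mul_assoc, smul_avgMat_mul_dualMat hgraph hlam] at hinv
  exact eq_sub_of_add_eq hinv

lemma dualMat_mul_L (hgraph : S.UndirectedConnected) {lam : ℝ} (hlam : 0 < lam) :
    S.dualMat lam * S.L = centerMat n := by
  simpa [dualMat_transpose hgraph, L_transpose hgraph, centerMat_transpose] using
    congrArg transpose (L_mul_dualMat hgraph hlam)

end DualMatrix

end UnifiedCompression.Setting

/-! ### Stacked vectors -/

namespace UnifiedCompression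

open Matrix

/-- Stacked vectors `col(x_1, …, x_n)` with the Euclidean inner product of `ℝ^{nd}`. -/
abbrev Stack (n d : ℕ) : Type := PiLp 2 fun _ : Fin n => Vec d

/-- The stacked vector with blocks `x i`. -/
abbrev stack {n d : ℕ} (x : Fin n → Vec d) : Stack n d := WithLp.toLp 2 x

/-- The operator `M ⊗ I_d` on stacked vectors, as an algebra homomorphism in `M`. -/
def kron {n : ℕ} (d : ℕ) : Matrix (Fin n) (Fin n) ℝ →ₐ[ℝ] Module.End ℝ (Stack n d) :=
  AlgHom.ofLinearMap
    (LinearMap.mk₂ ℝ (fun M x => stack fun i => ∑ j, M i j • x j)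
      (fun M N x => by ext; simp [add_mul, Finset.sum_add_distrib])
      (fun c M x => by ext; simp [Finset.mul_sum, mul_assoc])
      (fun M x y => by ext; simp [Finset.sum_add_distrib])
      (fun c M x => by ext; simp [Finset.mul_sum, mul_left_comm]))
    (by ext; simp [Matrix.one_apply])
    (fun M N => by
      ext x i a
      simp only [LinearMap.mk₂_apply, Module.End.mul_apply, Matrix.mul_apply, WithLp.ofLp_sum,
        WithLp.ofLp_smul, Finset.sum_apply, Pi.smul_apply, smul_eq_mul, Finset.mul_sum,
        Finset.sum_mul, mul_assoc]
      exact Finset.sum_comm)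

/-- Stacked vectors whose blocks sum to zero, the range of `E ⊗ I_d`. -/
def zeroAvg (n d : ℕ) : Submodule ℝ (Stack n d) := LinearMap.ker (kron d (Setting.avgMat n))

/-- The `a`-th coordinate of every block. -/
def coord {n d : ℕ} (a : Fin d) (x : Stack n d) : Fin n → ℝ := fun i => x i a

section Kron

variable {n d : ℕ}

lemma kron_apply (M : Matrix (Fin n) (Fin n) ℝ) (x : Stack n d) (i : Fin n) :
    kron d M x i = ∑ j, M i j • x j := rfl

lemma kron_mul_apply (M N : Matrix (Fin n) (Fin n) ℝ) (x : Stack n d) :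
    kron d (M * N) x = kron d M (kron d N x) := by
  rw [map_mul, Module.End.mul_apply]

lemma coord_kron (M : Matrix (Fin n) (Fin n) ℝ) (a : Fin d) (x : Stack n d) :
    coord a (kron d M x) = M *ᵥ coord a x := by
  ext i
  simp [coord, kron_apply, mulVec, dotProduct]

lemma inner_eq_sum_coord (x y : Stack n d) : ⟪x, y⟫_ℝ = ∑ a, coord a x ⬝ᵥ coord a y := by
  simp only [PiLp.inner_apply, RCLike.inner_apply, coord, dotProduct, conj_trivial]
  rw [Finset.sum_comm]
  simp only [mul_comm]

lemma inner_kron_eq_stackedForm (M : Matrix (Fin n) (Fin n) ℝ) (x y : Stack n d) :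
    ⟪x, kron d M y⟫_ℝ = Setting.stackedForm M x y := by
  simp only [PiLp.inner_apply (x := x), kron_apply, inner_sum, real_inner_smul_right,
    Setting.stackedForm]

lemma kron_isSymmetric {M : Matrix (Fin n) (Fin n) ℝ} (hM : Mᵀ = M) :
    (kron d M).IsSymmetric := fun x y => by
  simp only [inner_eq_sum_coord, coord_kron, dotProduct_mulVec, ← mulVec_transpose, hM]

lemma mem_zeroAvg {x : Stack n d} : x ∈ zeroAvg n d ↔ kron d (Setting.avgMat n) x = 0 :=
  LinearMap.mem_ker

lemma kron_apply_mem_zeroAvg {M : Matrix (Fin n) (Fin n) ℝ} (hM : Setting.avgMat n * M = 0)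
    (x : Stack n d) : kron d M x ∈ zeroAvg n d := by
  rw [mem_zeroAvg, ← kron_mul_apply, hM, map_zero, LinearMap.zero_apply]

lemma sum_coord_eq_zero {x : Stack n d} (hx : x ∈ zeroAvg n d) (a : Fin d) :
    ∑ i, coord a x i = 0 := by
  obtain rfl | hn := Nat.eq_zero_or_pos n
  · simp
  have h := congrFun (coord_kron (Setting.avgMat n) a x) ⟨0, hn⟩
  rw [mem_zeroAvg.1 hx, Setting.avgMat_mulVec] at h
  exact (mul_eq_zero.1 h.symm).resolve_left (by positivity)

end Kron

namespace Setting

variable {n d : ℕ} {S : Setting n d}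

lemma kron_avgMat_apply (x : Stack n d) (i : Fin n) : kron d (avgMat n) x i = avg x := by
  rw [kron_apply, avg, Finset.smul_sum]
  rfl

lemma kron_centerMat (x : Stack n d) :
    kron d (centerMat n) x = x - kron d (avgMat n) x := by
  rw [centerMat, map_sub, map_one, LinearMap.sub_apply, Module.End.one_apply]

lemma kron_centerMat_of_mem {x : Stack n d} (hx : x ∈ zeroAvg n d) :
    kron d (centerMat n) x = x := by
  rw [kron_centerMat, mem_zeroAvg.1 hx, sub_zero]

lemma kron_centerMat_mem (x : Stack n d) : kron d (centerMat n) x ∈ zeroAvg n d :=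
  kron_apply_mem_zeroAvg (by rw [centerMat, mul_sub, mul_one, avgMat_mul_avgMat, sub_self]) x

end Setting

end UnifiedCompression

/-! ### Symmetric operators with a spectral gap -/

namespace UnifiedCompression

section SpectralBounds

variable {H : Type*} [NormedAddCommGroup H] [InnerProductSpace ℝ H]

/-- The properties of the stacked Laplacian that the consensus analysis uses: `L` is symmetric, its
spectrum lies in `[0, ρ]`, and on the subspace `K` of zero-average stacks it is at least `ρ₂`. The
upper bound is encoded as `L² ≤ ρ L`, which contains `0 ≤ L`. -/
structure SpectralBounds (L : H →ₗ[ℝ] H) (K : Submodule ℝ H) (ρ₂ ρ : ℝ) : Prop where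
  isSymmetric : L.IsSymmetric
  lower_pos : 0 < ρ₂
  lower_le_upper : ρ₂ ≤ ρ
  norm_sq_le : ∀ a, ‖L a‖ ^ 2 ≤ ρ * ⟪a, L a⟫_ℝ
  mul_norm_sq_le : ∀ a ∈ K, ρ₂ * ‖a‖ ^ 2 ≤ ⟪a, L a⟫_ℝ

lemma mul_le_add_of_sq_le {k m s t A B : ℝ} (hk : k ^ 2 ≤ 4 * s * t) (hm : m ^ 2 ≤ A * B)
    (hs : 0 ≤ s) (ht : 0 ≤ t) (hA : 0 ≤ A) (hB : 0 ≤ B) : k * m ≤ s * A + t * B := by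
  refine (abs_le_of_sq_le_sq' ?_ (by positivity)).2
  calc (k * m) ^ 2 = k ^ 2 * m ^ 2 := mul_pow k m 2
    _ ≤ 4 * s * t * (A * B) := by gcongr
    _ ≤ (s * A + t * B) ^ 2 := by linarith [sq_nonneg (s * A - t * B)]

lemma mul_inner_le {k s t A B : ℝ} {a b : H} (hk : k ^ 2 ≤ 4 * s * t) (hs : 0 ≤ s) (ht : 0 ≤ t)
    (ha : ‖a‖ ^ 2 ≤ A) (hb : ‖b‖ ^ 2 ≤ B) : k * ⟪a, b⟫_ℝ ≤ s * A + t * B := by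
  have hA := (sq_nonneg _).trans ha
  refine mul_le_add_of_sq_le hk ?_ hs ht hA ((sq_nonneg _).trans hb)
  calc ⟪a, b⟫_ℝ ^ 2 = |⟪a, b⟫_ℝ| ^ 2 := (sq_abs _).symm
    _ ≤ (‖a‖ * ‖b‖) ^ 2 := by
      gcongr
      exact abs_real_inner_le_norm a b
    _ = ‖a‖ ^ 2 * ‖b‖ ^ 2 := mul_pow _ _ 2
    _ ≤ A * B := by gcongr

lemma norm_add_sq_le_two_mul (a b : H) : ‖a + b‖ ^ 2 ≤ 2 * ‖a‖ ^ 2 + 2 * ‖b‖ ^ 2 := by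
  linarith [parallelogram_law_with_norm ℝ a b, mul_self_nonneg ‖a - b‖, sq ‖a + b‖, sq ‖a‖, sq ‖b‖]

lemma norm_sub_sq_le_two_mul (a b : H) : ‖a - b‖ ^ 2 ≤ 2 * ‖a‖ ^ 2 + 2 * ‖b‖ ^ 2 := by
  simpa only [sub_eq_add_neg, norm_neg] using norm_add_sq_le_two_mul a (-b)

namespace SpectralBounds

variable {L : H →ₗ[ℝ] H} {K : Submodule ℝ H} {ρ₂ ρ : ℝ} (hL : SpectralBounds L K ρ₂ ρ)
include hL

lemma upper_pos : 0 < ρ := hL.lower_pos.trans_le hL.lower_le_upper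

lemma inner_nonneg (a : H) : 0 ≤ ⟪a, L a⟫_ℝ :=
  nonneg_of_mul_nonneg_right ((sq_nonneg _).trans (hL.norm_sq_le a)) hL.upper_pos

lemma inner_comm (a b : H) : ⟪a, L b⟫_ℝ = ⟪b, L a⟫_ℝ := by
  rw [← hL.isSymmetric, real_inner_comm]

lemma norm_le (a : H) : ‖L a‖ ≤ ρ * ‖a‖ := by
  have := hL.upper_pos
  rcases (norm_nonneg (L a)).eq_or_lt with hzero | hpos
  · rw [← hzero]
    positivity
  · refine le_of_mul_le_mul_right ?_ hpos
    calc ‖L a‖ * ‖L a‖ = ‖L a‖ ^ 2 := (sq _).symm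
      _ ≤ ρ * (‖a‖ * ‖L a‖) := (hL.norm_sq_le a).trans (by gcongr; exact real_inner_le_norm _ _)
      _ = ρ * ‖a‖ * ‖L a‖ := (mul_assoc ..).symm

lemma inner_le (a : H) : ⟪a, L a⟫_ℝ ≤ ρ * ‖a‖ ^ 2 := by
  calc ⟪a, L a⟫_ℝ ≤ ‖a‖ * (ρ * ‖a‖) := by
        refine (real_inner_le_norm _ _).trans ?_
        gcongr
        exact hL.norm_le a
    _ = ρ * ‖a‖ ^ 2 := by ring

lemma norm_sq_le_inv_mul {a : H} (ha : a ∈ K) : ‖a‖ ^ 2 ≤ ρ₂⁻¹ * ⟪a, L a⟫_ℝ := by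
  rw [← div_eq_inv_mul, le_div_iff₀' hL.lower_pos]
  exact hL.mul_norm_sq_le a ha

lemma norm_le_inv_mul {a : H} (ha : a ∈ K) : ‖a‖ ≤ ρ₂⁻¹ * ‖L a‖ := by
  have := hL.lower_pos
  rcases (norm_nonneg a).eq_or_lt with hzero | hpos
  · rw [← hzero]
    positivity
  · refine le_of_mul_le_mul_right ?_ hpos
    calc ‖a‖ * ‖a‖ = ‖a‖ ^ 2 := (sq _).symm
      _ ≤ ρ₂⁻¹ * (‖a‖ * ‖L a‖) :=
        (hL.norm_sq_le_inv_mul ha).trans (by gcongr; exact real_inner_le_norm _ _)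
      _ = ρ₂⁻¹ * ‖L a‖ * ‖a‖ := by ring

lemma norm_sq_le_inv_sq_mul {a : H} (ha : a ∈ K) : ‖a‖ ^ 2 ≤ ρ₂⁻¹ ^ 2 * ‖L a‖ ^ 2 := by
  rw [← mul_pow]
  gcongr
  exact hL.norm_le_inv_mul ha

lemma inner_le_inv_mul {a : H} (ha : a ∈ K) : ⟪a, L a⟫_ℝ ≤ ρ₂⁻¹ * ‖L a‖ ^ 2 := by
  calc ⟪a, L a⟫_ℝ ≤ ρ₂⁻¹ * ‖L a‖ * ‖L a‖ := by
        refine (real_inner_le_norm _ _).trans ?_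
        gcongr
        exact hL.norm_le_inv_mul ha
    _ = ρ₂⁻¹ * ‖L a‖ ^ 2 := by ring

lemma inner_sq_le (a b : H) : ⟪L a, b⟫_ℝ ^ 2 ≤ ⟪a, L a⟫_ℝ * ⟪b, L b⟫_ℝ := by
  rw [hL.isSymmetric]
  have h := discrim_le_zero (a := ⟪a, L a⟫_ℝ) (b := 2 * ⟪a, L b⟫_ℝ) (c := ⟪b, L b⟫_ℝ) fun t => by
    have h := hL.inner_nonneg (t • a + b)
    simp only [map_add, map_smul, inner_add_left, inner_add_right, real_inner_smul_left,
      real_inner_smul_right, hL.inner_comm b a] at h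
    linarith
  rw [discrim] at h
  linarith

end SpectralBounds

end SpectralBounds

end UnifiedCompression

/-! ### One step of the quadratic Lyapunov function -/

namespace UnifiedCompression

variable {H : Type*} [NormedAddCommGroup H] [InnerProductSpace ℝ H]

/-- The part of the Lyapunov function that is quadratic in the consensus error `x` and the
dual error `u`. -/
def quadLyapunov (β γ : ℝ) (L : H →ₗ[ℝ] H) (x u : H) : ℝ :=
  1 / 2 * ‖x‖ ^ 2 + (β + γ) / (2 * γ) * ⟪u, L u⟫_ℝ + ⟪x, u⟫_ℝ

namespace SpectralBounds

variable {L : H →ₗ[ℝ] H} {K : Submodule ℝ H} {ρ₂ ρ : ℝ} (hL : SpectralBounds L K ρ₂ ρ)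
include hL

/-- `z` is the compressed consensus error, `h` the deviation of the local gradients from their
values at the average, and `r` the image under `L⁻¹` of the rate of change of the latter. -/
lemma quadLyapunov_step_eq {β γ : ℝ} (hγ : γ ≠ 0) (α : ℝ) (x z u h r : H) :
    quadLyapunov β γ L (x - α • (β • L z + γ • L u + h))
        (u + (α * γ) • z + (α * γ⁻¹) • r) =
      quadLyapunov β γ L x u
      + α * (-β * ⟪x, L z⟫_ℝ + γ * ⟪x, z⟫_ℝ - γ * ⟪L u, x - z⟫_ℝ - γ * ⟪u, L u⟫_ℝ
          - ⟪x, h⟫_ℝ - ⟪h, u⟫_ℝ + (γ⁻¹ * ⟪x, r⟫_ℝ + (β + γ) / γ ^ 2 * ⟪L u, r⟫_ℝ))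
      + α ^ 2 * (1 / 2 * ‖β • L z + (γ • L u + h)‖ ^ 2 - γ * ⟪γ • L u + h, z⟫_ℝ
          + (γ ^ 2 - β * γ) / 2 * ⟪z, L z⟫_ℝ
          + (⟪z, L r⟫_ℝ - ⟪L u, r⟫_ℝ - γ⁻¹ * ⟪h, r⟫_ℝ
            + (β + γ) / (2 * γ ^ 3) * ⟪r, L r⟫_ℝ)) := by
  have hflip : ∀ a b, ⟪L a, b⟫_ℝ = ⟪b, L a⟫_ℝ := fun a b => real_inner_comm _ _
  simp only [quadLyapunov, ← real_inner_self_eq_norm_sq, map_add, map_smul, inner_add_left,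
    inner_add_right, inner_sub_left, inner_sub_right, real_inner_smul_left,
    real_inner_smul_right, hflip z x, hflip z z, hflip z u, hflip z h, hflip z r, hflip u x,
    hflip u z, hflip u u, hflip u h, hflip u r, hL.inner_comm u z, hL.inner_comm r u,
    hL.inner_comm r z, real_inner_comm (L u) (L z), real_inner_comm x h, real_inner_comm u h]
  field_simp
  ring

lemma neg_inner_sub_le {x : H} (hx : x ∈ K) (e : H) :
    -⟪x, L (x - e)⟫_ℝ ≤ -(ρ₂ / 2) * ‖x‖ ^ 2 + ρ / 2 * ‖e‖ ^ 2 := by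
  have hdiff := hL.inner_nonneg (x - e)
  simp only [map_sub, inner_sub_left, inner_sub_right, hL.inner_comm e x] at hdiff ⊢
  linarith [hL.inner_le e, hL.mul_norm_sq_le x hx]

lemma consensus_first_order_le {β γ ℓ : ℝ} (hβ : 0 ≤ β) (hγ : 0 ≤ γ) {x u h : H} (e : H)
    (hx : x ∈ K) (hu : u ∈ K) (hh : ‖h‖ ^ 2 ≤ ℓ ^ 2 * ‖x‖ ^ 2) :
    -β * ⟪x, L (x - e)⟫_ℝ + γ * ⟪x, x - e⟫_ℝ - γ * ⟪L u, e⟫_ℝ - γ * ⟪u, L u⟫_ℝ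
        - ⟪x, h⟫_ℝ - ⟪h, u⟫_ℝ ≤
      (-(ρ₂ / 2 * β) + 3 / 2 * γ + 1 / 2 + ℓ ^ 2) * ‖x‖ ^ 2
      + (-(3 / 4 * γ) + 1 / 2 * ρ₂⁻¹) * ⟪u, L u⟫_ℝ
      + ((ρ + 1 / 2) * γ + 1 / 2 * ρ * β) * ‖e‖ ^ 2 := by
  have hxLe := mul_le_mul_of_nonneg_left (hL.neg_inner_sub_le hx e) hβ
  have hxe : -γ * ⟪x, e⟫_ℝ ≤ γ / 2 * ‖x‖ ^ 2 + γ / 2 * ‖e‖ ^ 2 :=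
    mul_inner_le (by linarith) (by positivity) (by positivity) le_rfl le_rfl
  have hue : -γ * ⟪L u, e⟫_ℝ ≤ γ / 4 * ⟪u, L u⟫_ℝ + γ * (ρ * ‖e‖ ^ 2) :=
    mul_le_add_of_sq_le (by linarith)
      ((hL.inner_sq_le u e).trans
        (mul_le_mul_of_nonneg_left (hL.inner_le e) (hL.inner_nonneg u)))
      (by positivity) hγ (hL.inner_nonneg u) ((hL.inner_nonneg e).trans (hL.inner_le e))
  have hxh : -1 * ⟪x, h⟫_ℝ ≤ 1 / 2 * ‖x‖ ^ 2 + 1 / 2 * (ℓ ^ 2 * ‖x‖ ^ 2) :=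
    mul_inner_le (by norm_num) (by norm_num) (by norm_num) le_rfl hh
  have hhu : -1 * ⟪h, u⟫_ℝ ≤ 1 / 2 * (ℓ ^ 2 * ‖x‖ ^ 2) + 1 / 2 * (ρ₂⁻¹ * ⟪u, L u⟫_ℝ) :=
    mul_inner_le (by norm_num) (by norm_num) (by norm_num) hh (hL.norm_sq_le_inv_mul hu)
  rw [inner_sub_right x, real_inner_self_eq_norm_sq]
  linarith

lemma gradient_first_order_le {β γ D : ℝ} (hγ : 0 < γ) {r : H} (x u : H)
    (hr : r ∈ K) (hD : ‖L r‖ ^ 2 ≤ D) :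
    γ⁻¹ * ⟪x, r⟫_ℝ + (β + γ) / γ ^ 2 * ⟪L u, r⟫_ℝ ≤
      1 / 2 * ‖x‖ ^ 2 + γ / 4 * ⟪u, L u⟫_ℝ
      + ((β + γ) ^ 2 / γ ^ 5 * ρ₂⁻¹ + 1 / (2 * γ ^ 2) * ρ₂⁻¹ ^ 2) * D := by
  have hρ₂ := hL.lower_pos
  have hnorm : ‖r‖ ^ 2 ≤ ρ₂⁻¹ ^ 2 * D := (hL.norm_sq_le_inv_sq_mul hr).trans (by gcongr)
  have hform : ⟪r, L r⟫_ℝ ≤ ρ₂⁻¹ * D := (hL.inner_le_inv_mul hr).trans (by gcongr)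
  have hxr : γ⁻¹ * ⟪x, r⟫_ℝ ≤ 1 / 2 * ‖x‖ ^ 2 + 1 / (2 * γ ^ 2) * (ρ₂⁻¹ ^ 2 * D) :=
    mul_inner_le (by field_simp; norm_num) (by norm_num) (by positivity) le_rfl hnorm
  have hur : (β + γ) / γ ^ 2 * ⟪L u, r⟫_ℝ ≤
      γ / 4 * ⟪u, L u⟫_ℝ + (β + γ) ^ 2 / γ ^ 5 * (ρ₂⁻¹ * D) :=
    mul_le_add_of_sq_le (by field_simp; norm_num)
      ((hL.inner_sq_le u r).trans (mul_le_mul_of_nonneg_left hform (hL.inner_nonneg u)))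
      (by positivity) (by positivity) (hL.inner_nonneg u) ((hL.inner_nonneg r).trans hform)
  linarith

lemma consensus_second_order_le {β γ : ℝ} (hβ : 0 ≤ β) (hγ : 0 ≤ γ) {z : H} (hz : z ∈ K) (q : H) :
    1 / 2 * ‖β • L z + q‖ ^ 2 - γ * ⟪q, z⟫_ℝ + (γ ^ 2 - β * γ) / 2 * ⟪z, L z⟫_ℝ ≤
      ‖q‖ ^ 2 + (β ^ 2 * ρ ^ 2 - 3 / 2 * β * γ * ρ₂ + γ ^ 2 / 2 + γ ^ 2 * ρ / 2) * ‖z‖ ^ 2 := by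
  have hsq : 0 ≤ ‖q - (β • L z - γ • z)‖ ^ 2 := sq_nonneg _
  have hLz : β ^ 2 * ‖L z‖ ^ 2 ≤ β ^ 2 * (ρ * ‖z‖) ^ 2 := by
    gcongr
    exact hL.norm_le z
  have hupper : γ ^ 2 / 2 * ⟪z, L z⟫_ℝ ≤ γ ^ 2 / 2 * (ρ * ‖z‖ ^ 2) := by
    gcongr
    exact hL.inner_le z
  have hlower : 3 / 2 * (β * γ) * (ρ₂ * ‖z‖ ^ 2) ≤ 3 / 2 * (β * γ) * ⟪z, L z⟫_ℝ := by
    gcongr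
    exact hL.mul_norm_sq_le z hz
  simp only [mul_pow, ← real_inner_self_eq_norm_sq, inner_add_left, inner_add_right,
    inner_sub_left, inner_sub_right, real_inner_smul_left, real_inner_smul_right,
    real_inner_comm z (L z), real_inner_comm q (L z), real_inner_comm q z]
    at hsq hLz hupper hlower ⊢
  linarith

lemma gradient_second_order_le {β γ ℓ D : ℝ} (hβ : 0 ≤ β) (hγ : 0 < γ) {x h r : H} (e u : H)
    (hr : r ∈ K) (hh : ‖h‖ ^ 2 ≤ ℓ ^ 2 * ‖x‖ ^ 2) (hD : ‖L r‖ ^ 2 ≤ D) :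
    ⟪x - e, L r⟫_ℝ - ⟪L u, r⟫_ℝ - γ⁻¹ * ⟪h, r⟫_ℝ + (β + γ) / (2 * γ ^ 3) * ⟪r, L r⟫_ℝ ≤
      (1 + 1 / 2 * ℓ ^ 2) * ‖x‖ ^ 2 + 1 / 2 * ρ * ⟪u, L u⟫_ℝ + ‖e‖ ^ 2
      + ((β + γ) / (2 * γ ^ 3) * ρ₂⁻¹ + 1 / (2 * γ ^ 2) * ρ₂⁻¹ ^ 2 + ρ₂⁻¹ ^ 2 / 2 + 1 / 2)
        * D := by
  have hρ₂ := hL.lower_pos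
  have hnorm : ‖r‖ ^ 2 ≤ ρ₂⁻¹ ^ 2 * D := (hL.norm_sq_le_inv_sq_mul hr).trans (by gcongr)
  have hxe : 1 * ⟪x - e, L r⟫_ℝ ≤ 1 / 2 * (2 * ‖x‖ ^ 2 + 2 * ‖e‖ ^ 2) + 1 / 2 * D :=
    mul_inner_le (by norm_num) (by norm_num) (by norm_num) (norm_sub_sq_le_two_mul x e) hD
  have hur : -1 * ⟪L u, r⟫_ℝ ≤ 1 / 2 * (ρ * ⟪u, L u⟫_ℝ) + 1 / 2 * (ρ₂⁻¹ ^ 2 * D) :=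
    mul_inner_le (by norm_num) (by norm_num) (by norm_num) (hL.norm_sq_le u) hnorm
  have hhr : -γ⁻¹ * ⟪h, r⟫_ℝ ≤
      1 / 2 * (ℓ ^ 2 * ‖x‖ ^ 2) + 1 / (2 * γ ^ 2) * (ρ₂⁻¹ ^ 2 * D) :=
    mul_inner_le (by field_simp; norm_num) (by norm_num) (by positivity) hh hnorm
  have hrr : (β + γ) / (2 * γ ^ 3) * ⟪r, L r⟫_ℝ ≤ (β + γ) / (2 * γ ^ 3) * (ρ₂⁻¹ * D) := by
    gcongr
    exact (hL.inner_le_inv_mul hr).trans (by gcongr)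
  linarith

lemma norm_smul_add_sq_le {γ ℓ : ℝ} {x h : H} (u : H) (hh : ‖h‖ ^ 2 ≤ ℓ ^ 2 * ‖x‖ ^ 2) :
    ‖γ • L u + h‖ ^ 2 ≤ 2 * (γ ^ 2 * (ρ * ⟪u, L u⟫_ℝ)) + 2 * (ℓ ^ 2 * ‖x‖ ^ 2) := by
  refine (norm_add_sq_le_two_mul _ _).trans ?_
  rw [norm_smul, mul_pow, Real.norm_eq_abs, sq_abs]
  gcongr
  exact hL.norm_sq_le u

lemma quadLyapunov_step_le {α β γ ℓ D : ℝ} (hα : 0 ≤ α) (hγ : 0 < γ) (hβγ : γ ≤ β * ρ)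
    {x e u h r : H} (hx : x ∈ K) (he : e ∈ K) (hu : u ∈ K) (hr : r ∈ K)
    (hh : ‖h‖ ^ 2 ≤ ℓ ^ 2 * ‖x‖ ^ 2) (hD : ‖L r‖ ^ 2 ≤ D) :
    quadLyapunov β γ L (x - α • (β • L (x - e) + γ • L u + h))
        (u + (α * γ) • (x - e) + (α * γ⁻¹) • r) ≤
      quadLyapunov β γ L x u
      - α * (1 / 2 * (ρ₂ * β - (3 * γ + 2 + 2 * ℓ ^ 2))
          - α * (3 * ρ ^ 2 * β ^ 2 - ρ₂ * β * γ + (ρ + 2) * γ ^ 2 + 1 + 5 / 2 * ℓ ^ 2)) * ‖x‖ ^ 2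
      - α * (γ / 2 - 5 / 2 * ρ₂⁻¹ - α * (2 * ρ * γ ^ 2 + 1 / 2 * ρ)) * ⟪u, L u⟫_ℝ
      + α * ((ρ + 1) * γ + 1 / 2 * ρ * β
          + α * (3 * ρ ^ 2 * β ^ 2 + (ρ - 2 * ρ₂) * β * γ + (ρ + 2) * γ ^ 2 + 1)) * ‖e‖ ^ 2
      + α * ((β + γ) ^ 2 / γ ^ 5 * ρ₂⁻¹ + 1 / (2 * γ ^ 2) * ρ₂⁻¹ ^ 2
          + α * ((β + γ) / (2 * γ ^ 3) * ρ₂⁻¹ + 1 / (2 * γ ^ 2) * ρ₂⁻¹ ^ 2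
            + ρ₂⁻¹ ^ 2 / 2 + 1 / 2)) * D := by
  have hρ := hL.upper_pos
  have hρ₂ := hL.lower_pos
  have hβ : 0 < β := pos_of_mul_pos_left (hγ.trans_le hβγ) hρ.le
  have hW := hL.inner_nonneg u
  rw [hL.quadLyapunov_step_eq hγ.ne', sub_sub_cancel]
  set c := β ^ 2 * ρ ^ 2 - 3 / 2 * β * γ * ρ₂ + γ ^ 2 / 2 + γ ^ 2 * ρ / 2 with hc
  have hc_nonneg : 0 ≤ c := by
    have hfactor : 0 ≤ (β * ρ - γ) * (β * ρ - γ / 2) := mul_nonneg (by linarith) (by linarith)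
    have hspec : β * γ * ρ₂ ≤ β * γ * ρ := by gcongr; exact hL.lower_le_upper
    have : 0 ≤ γ ^ 2 * ρ := by positivity
    linarith
  have hfirst := mul_le_mul_of_nonneg_left (add_le_add
    (hL.consensus_first_order_le hβ.le hγ.le e hx hu hh)
    (hL.gradient_first_order_le (β := β) hγ x u hr hD)) hα
  have hsecond := mul_le_mul_of_nonneg_left (add_le_add
    ((hL.consensus_second_order_le hβ.le hγ.le (K.sub_mem hx he) (γ • L u + h)).trans
      (add_le_add (hL.norm_smul_add_sq_le u hh)
        (mul_le_mul_of_nonneg_left (norm_sub_sq_le_two_mul x e) hc_nonneg)))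
    (hL.gradient_second_order_le hβ.le hγ e u hr hh hD)) (sq_nonneg α)
  have hx_slack : 0 ≤ α ^ 2 * (ρ ^ 2 * β ^ 2 + 2 * ρ₂ * β * γ + γ ^ 2) * ‖x‖ ^ 2 := by positivity
  have hu_slack : 0 ≤ α * (2 * ρ₂⁻¹) * ⟪u, L u⟫_ℝ := by positivity
  have he_slack : 0 ≤ α * (1 / 2 * γ) * ‖e‖ ^ 2
      + α ^ 2 * (ρ ^ 2 * β ^ 2 + (ρ + ρ₂) * β * γ + γ ^ 2) * ‖e‖ ^ 2 := by positivity
  linarith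

end SpectralBounds

end UnifiedCompression

/-! ### Descent lemma and stacked gradients -/

namespace UnifiedCompression

section DescentLemma

variable {H : Type*} [NormedAddCommGroup H] [InnerProductSpace ℝ H] [CompleteSpace H]
  {φ : H → ℝ} {ℓ : ℝ}

lemma inner_gradient_sub_gradient_le
    (hlip : ∀ x y, ‖gradient φ x - gradient φ y‖ ≤ ℓ * ‖x - y‖) (x h : H) {t : ℝ} (ht : 0 ≤ t) :
    ⟪gradient φ (x + t • h) - gradient φ x, h⟫_ℝ ≤ ℓ * t * ‖h‖ ^ 2 :=
  calc ⟪gradient φ (x + t • h) - gradient φ x, h⟫_ℝ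
      ≤ ‖gradient φ (x + t • h) - gradient φ x‖ * ‖h‖ := real_inner_le_norm _ _
    _ ≤ ℓ * ‖x + t • h - x‖ * ‖h‖ := by
      gcongr
      exact hlip _ _
    _ = ℓ * t * ‖h‖ ^ 2 := by
      rw [add_sub_cancel_left, norm_smul, Real.norm_of_nonneg ht]
      ring

lemma le_add_inner_gradient_add_sq (hφ : Differentiable ℝ φ)
    (hlip : ∀ x y, ‖gradient φ x - gradient φ y‖ ≤ ℓ * ‖x - y‖) (x h : H) :
    φ (x + h) ≤ φ x + ⟪gradient φ x, h⟫_ℝ + ℓ / 2 * ‖h‖ ^ 2 := by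
  have hline (t : ℝ) : HasDerivAt (fun t : ℝ => φ (x + t • h)) ⟪gradient φ (x + t • h), h⟫_ℝ t := by
    have hadd : HasDerivAt (fun t : ℝ => x + t • h) h t := by
      simpa only [one_smul] using ((hasDerivAt_id' t).smul_const h).const_add x
    rw [inner_gradient_left]
    exact (hφ (x + t • h)).hasFDerivAt.comp_hasDerivAt t hadd
  have hbound (t : ℝ) : HasDerivAt
      (fun t : ℝ => φ x + t * ⟪gradient φ x, h⟫_ℝ + t ^ 2 * (ℓ / 2 * ‖h‖ ^ 2))
      (⟪gradient φ x, h⟫_ℝ + 2 * t * (ℓ / 2 * ‖h‖ ^ 2)) t := by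
    simpa only [one_mul, Nat.cast_ofNat, Nat.add_one_sub_one, pow_one] using
      (((hasDerivAt_id' t).mul_const ⟪gradient φ x, h⟫_ℝ).const_add (φ x)).fun_add
        ((hasDerivAt_pow 2 t).mul_const (ℓ / 2 * ‖h‖ ^ 2))
  have hcmp := image_le_of_deriv_right_le_deriv_boundary (a := 0) (b := 1)
    (fun t _ => (hline t).continuousAt.continuousWithinAt)
    (fun t _ => (hline t).hasDerivWithinAt) (by simp)
    (fun t _ => (hbound t).continuousAt.continuousWithinAt)
    (fun t _ => (hbound t).hasDerivWithinAt)
    (fun t ht => by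
      have hgrowth := inner_gradient_sub_gradient_le hlip x h ht.1
      rw [inner_sub_left] at hgrowth
      linarith) (Set.right_mem_Icc.2 zero_le_one)
  simpa using hcmp

lemma norm_gradient_sq_le {m : ℝ} (hℓ : 0 < ℓ) (hφ : Differentiable ℝ φ)
    (hlip : ∀ x y, ‖gradient φ x - gradient φ y‖ ≤ ℓ * ‖x - y‖) (hm : ∀ x, m ≤ φ x) (x : H) :
    ‖gradient φ x‖ ^ 2 ≤ 2 * ℓ * (φ x - m) := by
  have hstep : m ≤ φ x - 1 / (2 * ℓ) * ‖gradient φ x‖ ^ 2 :=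
    calc m ≤ φ (x + -(ℓ⁻¹ • gradient φ x)) := hm _
      _ ≤ φ x + ⟪gradient φ x, -(ℓ⁻¹ • gradient φ x)⟫_ℝ + ℓ / 2 * ‖-(ℓ⁻¹ • gradient φ x)‖ ^ 2 :=
        le_add_inner_gradient_add_sq hφ hlip x _
      _ = φ x - 1 / (2 * ℓ) * ‖gradient φ x‖ ^ 2 := by
        rw [inner_neg_right, real_inner_smul_right, real_inner_self_eq_norm_sq, norm_neg, norm_smul,
          mul_pow, Real.norm_eq_abs, sq_abs]
        field_simp
        ring
  have := (div_mul_eq_mul_div _ _ _).symm.trans_le (le_sub_comm.1 hstep)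
  rwa [one_mul, div_le_iff₀ (by positivity), mul_comm] at this

end DescentLemma

namespace Setting

variable {n d : ℕ} {S : Setting n d}

lemma spectralBounds_kron_L (hn : 2 ≤ n) (hgraph : S.UndirectedConnected) :
    SpectralBounds (kron d S.L) (zeroAvg n d) S.ρ₂ S.ρ where
  isSymmetric := kron_isSymmetric (L_transpose hgraph)
  lower_pos := ρ₂_pos hn hgraph
  lower_le_upper := ρ₂_le_ρ hn hgraph
  norm_sq_le x := by
    simp only [← real_inner_self_eq_norm_sq, inner_eq_sum_coord, coord_kron, Finset.mul_sum]
    exact Finset.sum_le_sum fun a _ => mulVec_dotProduct_mulVec_le (L_posSemidef hgraph) _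
  mul_norm_sq_le x hx := by
    simp only [← real_inner_self_eq_norm_sq, inner_eq_sum_coord, coord_kron, Finset.mul_sum]
    exact Finset.sum_le_sum fun a _ => ρ₂_mul_dotProduct_le hgraph (sum_coord_eq_zero hx a)

lemma avg_kron_of_avgMat_mul_eq_zero {M : Matrix (Fin n) (Fin n) ℝ} (hM : avgMat n * M = 0)
    (x : Stack n d) : avg (kron d M x) = 0 := by
  obtain rfl | hn := Nat.eq_zero_or_pos n
  · simp [avg]
  rw [← kron_avgMat_apply _ ⟨0, hn⟩, ← kron_mul_apply, hM, map_zero, LinearMap.zero_apply]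
  rfl

lemma avg_add (x y : Stack n d) : avg (x + y) = avg x + avg y := by
  simp only [avg, PiLp.add_apply, Finset.sum_add_distrib, smul_add]

lemma avg_sub (x y : Stack n d) : avg (x - y) = avg x - avg y := by
  simp only [avg, PiLp.sub_apply, Finset.sum_sub_distrib, smul_sub]

lemma avg_smul (c : ℝ) (x : Stack n d) : avg (c • x) = c • avg x := by
  simp only [avg, PiLp.smul_apply, ← Finset.smul_sum, smul_comm c]

lemma norm_kron_avgMat_sq (x : Stack n d) : ‖kron d (avgMat n) x‖ ^ 2 = n * ‖avg x‖ ^ 2 := by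
  simp only [PiLp.norm_sq_eq_of_L2, kron_avgMat_apply, Finset.sum_const, Finset.card_univ,
    Fintype.card_fin, nsmul_eq_mul]

lemma norm_sq_eq_center_add_avg (x : Stack n d) :
    ‖x‖ ^ 2 = ‖kron d (centerMat n) x‖ ^ 2 + n * ‖avg x‖ ^ 2 := by
  have horth : ⟪kron d (centerMat n) x, kron d (avgMat n) x⟫_ℝ = 0 := by
    rw [← kron_isSymmetric avgMat_transpose, mem_zeroAvg.1 (kron_centerMat_mem x), inner_zero_left]
  have hsplit := norm_add_sq_real (kron d (centerMat n) x) (kron d (avgMat n) x)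
  rw [horth, norm_kron_avgMat_sq, kron_centerMat, sub_add_cancel] at hsplit
  rw [hsplit, kron_centerMat]
  ring

lemma norm_avg_sq_le (x : Stack n d) : n * ‖avg x‖ ^ 2 ≤ ‖x‖ ^ 2 := by
  rw [norm_sq_eq_center_add_avg x]
  exact le_add_of_nonneg_left (sq_nonneg _)

lemma norm_center_sq_le (x : Stack n d) : ‖kron d (centerMat n) x‖ ^ 2 ≤ ‖x‖ ^ 2 := by
  rw [norm_sq_eq_center_add_avg x]
  exact le_add_of_nonneg_right (by positivity)

lemma differentiable_F (hs : S.Smooth) : Differentiable ℝ S.F := by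
  have := hs.differentiable
  unfold F
  fun_prop

lemma gradient_F (hs : S.Smooth) (x : Vec d) :
    gradient S.F x = avg fun i => gradient (S.f i) x := by
  have hsum : HasFDerivAt S.F ((1 / (n : ℝ)) • ∑ i, fderiv ℝ (S.f i) x) x :=
    (HasFDerivAt.fun_sum fun i _ => (hs.differentiable i x).hasFDerivAt).const_mul _
  refine HasGradientAt.gradient ?_
  rw [hasGradientAt_iff_hasFDerivAt, avg, map_smulₛₗ, map_sum, conj_trivial]
  simpa only [toDual_gradient] using hsum

lemma fStar_le (hopt : S.FiniteOptimum) (x : Vec d) : S.fStar ≤ S.F x := ciInf_le hopt x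

variable (S) in
/-- The local gradients, stacked, at the blocks of `x`. -/
def grad (x : Stack n d) : Stack n d := stack fun i => gradient (S.f i) (x i)

lemma norm_grad_sub_sq_le (hs : S.Smooth) (x y : Stack n d) :
    ‖S.grad x - S.grad y‖ ^ 2 ≤ S.ℓ ^ 2 * ‖x - y‖ ^ 2 := by
  rw [PiLp.norm_sq_eq_of_L2, PiLp.norm_sq_eq_of_L2, Finset.mul_sum]
  gcongr with i
  rw [← mul_pow]
  gcongr
  exact hs.lipschitz i (x i) (y i)

lemma avg_grad_kron_avgMat (hs : S.Smooth) (x : Stack n d) :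
    avg (S.grad (kron d (avgMat n) x)) = gradient S.F (avg x) := by
  simp only [grad, kron_avgMat_apply, gradient_F hs]

lemma gradient_F_lipschitz (hs : S.Smooth) (x y : Vec d) :
    ‖gradient S.F x - gradient S.F y‖ ≤ S.ℓ * ‖x - y‖ := by
  have hℓ := hs.ℓ_pos
  have havg : gradient S.F x - gradient S.F y =
      (1 / (n : ℝ)) • ∑ i, (gradient (S.f i) x - gradient (S.f i) y) := by
    rw [gradient_F hs, gradient_F hs, avg, avg, ← smul_sub, Finset.sum_sub_distrib]
  calc ‖gradient S.F x - gradient S.F y‖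
      ≤ 1 / (n : ℝ) * ∑ i, ‖gradient (S.f i) x - gradient (S.f i) y‖ := by
        rw [havg, norm_smul, Real.norm_of_nonneg (by positivity)]
        gcongr
        exact norm_sum_le _ _
    _ ≤ 1 / (n : ℝ) * ∑ _i : Fin n, S.ℓ * ‖x - y‖ := by
        gcongr with i
        exact hs.lipschitz i x y
    _ = n / n * (S.ℓ * ‖x - y‖) := by
        rw [Finset.sum_const, Finset.card_univ, Fintype.card_fin, nsmul_eq_mul]
        ring
    _ ≤ S.ℓ * ‖x - y‖ := mul_le_of_le_one_left (by positivity) (div_self_le_one _)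

lemma norm_gradient_F_sub_avg_grad_sq_le (hs : S.Smooth) (x : Stack n d) :
    n * ‖gradient S.F (avg x) - avg (S.grad x)‖ ^ 2 ≤ S.ℓ ^ 2 * ‖kron d (centerMat n) x‖ ^ 2 := by
  have havg : avg (S.grad (kron d (avgMat n) x) - S.grad x) =
      gradient S.F (avg x) - avg (S.grad x) := by
    rw [avg_sub, avg_grad_kron_avgMat hs]
  rw [← havg, kron_centerMat, norm_sub_rev]
  exact (norm_avg_sq_le _).trans ((norm_grad_sub_sq_le hs _ _).trans_eq (by rw [norm_sub_rev]))

lemma F_step_le (hs : S.Smooth) {α : ℝ} (hα : 0 ≤ α) (x : Stack n d) :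
    n * S.F (avg x - α • avg (S.grad x)) ≤ n * S.F (avg x)
      - α / 2 * (n * ‖gradient S.F (avg x)‖ ^ 2)
      - α * (1 / 2 - α * (S.ℓ / 2)) * (n * ‖avg (S.grad x)‖ ^ 2)
      + α / 2 * (S.ℓ ^ 2 * ‖kron d (centerMat n) x‖ ^ 2) := by
  have hdescent := le_add_inner_gradient_add_sq (differentiable_F hs) (gradient_F_lipschitz hs)
    (avg x) (-(α • avg (S.grad x)))
  rw [← sub_eq_add_neg, inner_neg_right, real_inner_smul_right, norm_neg, norm_smul, mul_pow,
    Real.norm_eq_abs, sq_abs] at hdescent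
  have hdeviation := norm_gradient_F_sub_avg_grad_sq_le hs x
  rw [norm_sub_sq_real] at hdeviation
  linarith [mul_le_mul_of_nonneg_left hdescent n.cast_nonneg,
    mul_le_mul_of_nonneg_left hdeviation (div_nonneg hα zero_le_two)]

end Setting

end UnifiedCompression

/-! ### Constants and admissible stepsizes -/

namespace UnifiedCompression.Setting

variable {n d : ℕ} {S : Setting n d}

lemma ε₅_pos (hcomp : S.LocallyBounded) (hω : 0 < S.ω) : 0 < S.ε₅ := by
  have hδ : S.δ ^ 2 / 2 < S.δ := by nlinarith [hcomp.δ_pos, hcomp.δ_le]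
  exact mul_pos (mul_pos hω hcomp.r_pos) (sub_pos.2 hδ)

lemma two_mul_ε₅_le_one (hcomp : S.LocallyBounded) (hω : 0 < S.ω) (hω' : S.ω ≤ 1 / S.r) :
    2 * S.ε₅ ≤ 1 := by
  have hωr : S.ω * S.r ≤ 1 := (le_div_iff₀ hcomp.r_pos).1 hω'
  have hωr_pos : 0 < S.ω * S.r := mul_pos hω hcomp.r_pos
  have hδ : S.δ - S.δ ^ 2 / 2 ≤ 1 / 2 := by linarith [sq_nonneg (S.δ - 1)]
  calc 2 * S.ε₅ ≤ 2 * (S.ω * S.r * (1 / 2)) := by unfold ε₅; gcongr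
    _ ≤ 1 := by linarith

variable (S) in
/-- The positivity facts about the constants that do not depend on the gains `τ₁` and `γ`. -/
structure Regular : Prop where
  n_pos : (0 : ℝ) < n
  ρ₂_pos : 0 < S.ρ₂
  ρ₂_le_ρ : S.ρ₂ ≤ S.ρ
  ℓ_pos : 0 < S.ℓ
  ν_pos : 0 < S.ν
  ε₅_pos : 0 < S.ε₅
  two_mul_ε₅_le_one : 2 * S.ε₅ ≤ 1
  dHat_pos : 0 < S.dHat
  dTilde_pos : 0 < S.dTilde

lemma regular (hn : 2 ≤ n) (hd : 1 ≤ d) (hcomp : S.LocallyBounded)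
    (hgraph : S.UndirectedConnected) (hsmooth : S.Smooth) (hPL : S.PolyakLojasiewicz)
    (hω : 0 < S.ω) (hω' : S.ω ≤ 1 / S.r) : S.Regular where
  n_pos := by positivity
  ρ₂_pos := ρ₂_pos hn hgraph
  ρ₂_le_ρ := ρ₂_le_ρ hn hgraph
  ℓ_pos := hsmooth.ℓ_pos
  ν_pos := hPL.ν_pos
  ε₅_pos := ε₅_pos hcomp hω
  two_mul_ε₅_le_one := two_mul_ε₅_le_one hcomp hω hω'
  dHat_pos := S.dHat_pos hd
  dTilde_pos := S.dTilde_pos hd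

namespace Regular

variable (hS : S.Regular)
include hS

lemma ρ_pos : 0 < S.ρ := hS.ρ₂_pos.trans_le hS.ρ₂_le_ρ

lemma one_sub_nonneg : 0 ≤ 1 - 2 * S.ε₅ := sub_nonneg.2 hS.two_mul_ε₅_le_one

lemma two_mul_abs_le : 2 * |S.ρ₂ * S.β * S.γ| ≤ S.ρ ^ 2 * S.β ^ 2 + S.γ ^ 2 :=
  calc 2 * |S.ρ₂ * S.β * S.γ| = 2 * (S.ρ₂ * |S.β| * |S.γ|) := by
        rw [abs_mul, abs_mul, abs_of_pos hS.ρ₂_pos]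
    _ ≤ 2 * (S.ρ * |S.β| * |S.γ|) := by
        have := hS.ρ₂_le_ρ
        gcongr
    _ ≤ (S.ρ * |S.β|) ^ 2 + |S.γ| ^ 2 := by linarith [two_mul_le_add_sq (S.ρ * |S.β|) |S.γ|]
    _ = S.ρ ^ 2 * S.β ^ 2 + S.γ ^ 2 := by rw [mul_pow, sq_abs, sq_abs]

lemma φ₂_pos : 0 < S.φ₂ := by
  have hρ := hS.ρ_pos
  have hcross := hS.two_mul_abs_le
  have hrest : 0 < 2 * S.ρ ^ 2 * S.β ^ 2 + (S.ρ + 1) * S.γ ^ 2 + 1 + 5 / 2 * S.ℓ ^ 2 := by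
    positivity
  unfold φ₂
  linarith [le_abs_self (S.ρ₂ * S.β * S.γ), abs_nonneg (S.ρ₂ * S.β * S.γ)]

lemma φ₄_pos : 0 < S.φ₄ := by
  have := hS.ρ_pos
  unfold φ₄
  positivity

end Regular

variable (S) in
/-- The gains are large enough for the consensus error and the dual error to contract. -/
structure Gains : Prop extends S.Regular where
  φ₁_pos : 0 < S.φ₁
  φ₃_pos : 0 < S.φ₃

namespace Gains

variable (hS : S.Gains)
include hS

lemma γ_pos : 0 < S.γ := by
  have hφ₃ := hS.φ₃_pos
  have := inv_pos.2 hS.ρ₂_pos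
  unfold φ₃ at hφ₃
  linarith

lemma three_mul_γ_lt : 3 * S.γ < S.ρ₂ * S.β := by
  have hφ₁ := hS.φ₁_pos
  unfold φ₁ at hφ₁
  linarith [sq_nonneg S.ℓ]

lemma three_lt : 3 < S.τ₁ * S.ρ₂ := by
  have h := hS.three_mul_γ_lt
  rw [β, mul_left_comm, ← mul_assoc] at h
  exact lt_of_mul_lt_mul_right h hS.γ_pos.le

lemma τ₁_pos : 0 < S.τ₁ := pos_of_mul_pos_left (zero_lt_three.trans hS.three_lt) hS.ρ₂_pos.le

lemma β_pos : 0 < S.β := mul_pos hS.τ₁_pos hS.γ_pos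

lemma γ_le_mul : S.γ ≤ S.β * S.ρ := by
  have := mul_le_mul_of_nonneg_right hS.ρ₂_le_ρ hS.β_pos.le
  linarith [hS.three_mul_γ_lt, hS.γ_pos]

lemma φ₆_pos : 0 < S.φ₆ := by
  have := hS.ρ₂_pos
  have := hS.γ_pos
  have := hS.β_pos
  have := hS.ℓ_pos
  unfold φ₆
  positivity

lemma φ₇_pos : 0 < S.φ₇ := by
  have := hS.ρ_pos
  have := hS.γ_pos
  have := hS.β_pos
  unfold φ₇
  positivity

lemma φ₈_pos : 0 < S.φ₈ := by
  have hρ := hS.ρ_pos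
  have hγ := hS.γ_pos
  have hβ := hS.β_pos
  have hcross := hS.two_mul_abs_le
  have hrest : 0 < 2 * S.ρ ^ 2 * S.β ^ 2 + S.ρ * S.β * S.γ + (S.ρ + 1) * S.γ ^ 2 + 1 := by
    positivity
  unfold φ₈
  linarith [le_abs_self (S.ρ₂ * S.β * S.γ)]

lemma ε₁_eq : S.ε₁ = 1 / 2 - 1 / (2 * (S.τ₁ * S.ρ₂)) := by
  have := hS.τ₁_pos
  have := hS.ρ₂_pos
  unfold ε₁
  field_simp

lemma ε₁_pos : 0 < S.ε₁ := by
  have hτ := hS.τ₁_pos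
  have hρ₂ := hS.ρ₂_pos
  exact div_pos (by linarith [hS.three_lt]) (by positivity)

lemma ε₁_le_half : S.ε₁ ≤ 1 / 2 := by
  have := mul_pos hS.τ₁_pos hS.ρ₂_pos
  rw [hS.ε₁_eq]
  exact sub_le_self _ (by positivity)

lemma one_le_ε₂ : 1 ≤ S.ε₂ :=
  le_max_of_le_left (by linarith [hS.three_lt])

lemma ψ₂_pos {α : ℝ} (hα : 0 < α) : 0 < S.ψ₂ α :=
  add_pos hS.φ₇_pos (mul_pos hα hS.φ₈_pos)

lemma ψ₃_pos : 0 < S.ψ₃ := by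
  have := hS.ρ_pos
  have := hS.ε₅_pos
  have := hS.β_pos
  have := hS.dHat_pos
  unfold ψ₃
  positivity

lemma ψ₄_pos : 0 < S.ψ₄ := by
  have := hS.ρ_pos
  have := hS.ε₅_pos
  have := hS.γ_pos
  have := hS.dHat_pos
  have := hS.ε₁_pos
  have : 0 < max (S.β ^ 2 * S.ρ ^ 2 + S.ℓ ^ 2) (S.γ ^ 2 * S.ρ) :=
    lt_max_of_lt_right (by positivity)
  unfold ψ₄
  positivity

lemma ψ₃_add_ψ₄_mul_pos {ψ₅ : ℝ} (hψ : 0 < ψ₅) : 0 < (1 - 2 * S.ε₅) * S.ψ₃ + S.ψ₄ * ψ₅ :=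
  add_pos_of_nonneg_of_pos (mul_nonneg hS.one_sub_nonneg hS.ψ₃_pos.le) (mul_pos hS.ψ₄_pos hψ)

lemma κ₆'_pos {ψ₅ : ℝ} (hψ : 0 < ψ₅) : 0 < S.κ₆' ψ₅ := by
  have := hS.ε₅_pos
  have := hS.ψ₃_add_ψ₄_mul_pos hψ
  unfold κ₆'
  positivity

end Gains

section Thresholds

lemma le_κ₂' : 2 + 3 * S.ℓ ^ 2 ≤ S.κ₂' := (le_max_left _ _).trans (le_max_left _ _)

lemma gains_of_κ₂'_lt (hS : S.Regular) (hτ : S.κ₁ < S.τ₁) (hγ : S.κ₂' < S.γ) : S.Gains where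
  toRegular := hS
  φ₁_pos := by
    have hγ_lb := (le_κ₂' (S := S)).trans_lt hγ
    have hτρ : 4 < S.τ₁ * S.ρ₂ := (div_lt_iff₀ hS.ρ₂_pos).1 hτ
    have hγ_pos : 0 < S.γ := hγ_lb.trans' (by positivity)
    have hβρ : 4 * S.γ < S.τ₁ * S.ρ₂ * S.γ := by gcongr
    unfold φ₁ β
    linarith
  φ₃_pos := by
    have hγ_lb : 5 / S.ρ₂ < S.γ := ((le_max_right _ _).trans (le_max_left _ _)).trans_lt hγ
    rw [div_eq_mul_inv] at hγ_lb
    unfold φ₃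
    linarith

lemma lt_γ_pow_three (hS : S.Regular) (hγ : S.κ₂' < S.γ) :
    16 * S.ℓ ^ 2 * (S.τ₁ + 1) ^ 2 / S.ρ₂ < S.γ ^ 3 := by
  have := hS.ρ₂_pos
  have hroot : (16 * S.ℓ ^ 2 * (S.τ₁ + 1) ^ 2 / S.ρ₂) ^ (1 / 3 : ℝ) < S.γ :=
    ((le_max_left _ _).trans (le_max_right _ _)).trans_lt hγ
  calc 16 * S.ℓ ^ 2 * (S.τ₁ + 1) ^ 2 / S.ρ₂
      = ((16 * S.ℓ ^ 2 * (S.τ₁ + 1) ^ 2 / S.ρ₂) ^ (1 / 3 : ℝ)) ^ 3 := by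
        rw [← Real.rpow_mul_natCast (by positivity)]
        norm_num
    _ < S.γ ^ 3 := by gcongr

lemma lt_γ_sq (hS : S.Regular) (hγ : S.κ₂' < S.γ) : 8 * S.ℓ ^ 2 / S.ρ₂ ^ 2 < S.γ ^ 2 := by
  have := hS.ρ₂_pos
  have := hS.ℓ_pos
  have hlt : 2 * √2 * S.ℓ / S.ρ₂ < S.γ :=
    ((le_max_right _ _).trans (le_max_right _ _)).trans_lt hγ
  calc 8 * S.ℓ ^ 2 / S.ρ₂ ^ 2 = (2 * √2 * S.ℓ / S.ρ₂) ^ 2 := by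
        rw [div_pow, mul_pow, mul_pow, Real.sq_sqrt zero_le_two]
        norm_num
    _ < S.γ ^ 2 := by gcongr

lemma φ₅_pos (hS : S.Gains) (hγ : S.κ₂' < S.γ) : 0 < S.φ₅ := by
  have hγ_pos := hS.γ_pos
  have hρ₂ := hS.ρ₂_pos
  have hfirst : (S.β + S.γ) ^ 2 / S.γ ^ 5 * S.ρ₂⁻¹ * S.ℓ ^ 2 < 1 / 16 :=
    calc (S.β + S.γ) ^ 2 / S.γ ^ 5 * S.ρ₂⁻¹ * S.ℓ ^ 2
        = (16 * S.ℓ ^ 2 * (S.τ₁ + 1) ^ 2 / S.ρ₂) / (16 * S.γ ^ 3) := by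
          unfold β
          field_simp
      _ < 1 / 16 := by
          rw [div_lt_iff₀ (by positivity)]
          linarith [lt_γ_pow_three hS.toRegular hγ]
  have hsecond : 1 / (2 * S.γ ^ 2) * S.ρ₂⁻¹ ^ 2 * S.ℓ ^ 2 < 1 / 16 :=
    calc 1 / (2 * S.γ ^ 2) * S.ρ₂⁻¹ ^ 2 * S.ℓ ^ 2
        = (8 * S.ℓ ^ 2 / S.ρ₂ ^ 2) / (16 * S.γ ^ 2) := by
          field_simp
          ring
      _ < 1 / 16 := by
          rw [div_lt_iff₀ (by positivity)]
          linarith [lt_γ_sq hS.toRegular hγ]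
  unfold φ₅
  linarith

end Thresholds

section ExistsAdmissible

lemma inv_φ₁_le_κ₅ (hS : S.Gains) : ((1 / S.φ₁ : ℝ) : EReal) ≤ S.κ₅ := by
  refine le_sInf ?_
  rintro _ ⟨a, ha, hroot, rfl⟩
  have hε₃ : S.ε₃ a ≤ S.φ₁ :=
    (min_le_left _ _).trans (sub_le_self _ (mul_pos ha hS.φ₂_pos).le)
  rw [EReal.coe_le_coe_iff, div_le_iff₀ hS.φ₁_pos, ← hroot]
  gcongr

variable (S) in
/-- A lower bound for `ε₆ α`, valid for all stepsizes `α ≤ κHat₀ / 2`. -/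
def ε₆Low : ℝ := min (S.ν / 2) (min (S.φ₁ / 2) (S.φ₃ / 2)) / S.ε₂

lemma ε₆Low_pos (hS : S.Gains) : 0 < S.ε₆Low :=
  div_pos (lt_min (half_pos hS.ν_pos) (lt_min (half_pos hS.φ₁_pos) (half_pos hS.φ₃_pos)))
    (one_pos.trans_le hS.one_le_ε₂)

lemma ε₆Low_le (hS : S.Gains) {α : ℝ} (hα : α ≤ S.κHat₀ / 2) : S.ε₆Low ≤ S.ε₆ α := by
  have hφ₂ : 2 * α ≤ S.φ₁ / S.φ₂ := by
    linarith [show S.κHat₀ ≤ S.φ₁ / S.φ₂ from min_le_left _ _]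
  have hφ₄ : 2 * α ≤ S.φ₃ / S.φ₄ := by
    linarith [show S.κHat₀ ≤ S.φ₃ / S.φ₄ from (min_le_right _ _).trans (min_le_left _ _)]
  rw [le_div_iff₀ hS.φ₂_pos] at hφ₂
  rw [le_div_iff₀ hS.φ₄_pos] at hφ₄
  have := hS.one_le_ε₂
  unfold ε₆Low ε₆ ε₃
  gcongr <;> linarith

lemma ψ₅Low_le (hS : S.Gains) {α : ℝ} (hα : 0 < α) (hα' : α ≤ S.κHat₀ / 2) :
    S.ψ₅Low α ≤ (1 - 2 * S.ε₅) * (S.φ₇ + S.κHat₀ * S.φ₈) / S.ε₆Low := by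
  have := hS.one_sub_nonneg
  have := hS.φ₇_pos
  have := hS.φ₈_pos
  have := ε₆Low_pos hS
  have := ε₆Low_le hS hα'
  have hακ : α ≤ S.κHat₀ := by linarith
  have : 0 ≤ (1 - 2 * S.ε₅) * (S.φ₇ + S.κHat₀ * S.φ₈) := by
    have := hα.trans_le hακ
    positivity
  unfold ψ₅Low ψ₂
  gcongr

lemma exists_admissible (hS : S.Gains) (hφ₅ : 0 < S.φ₅) :
    ∃ ψ₅ αMax : ℝ, 0 < αMax ∧ ∀ α : ℝ, 0 < α → α < αMax → S.Admissible α ψ₅ := by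
  have hκHat : 0 < S.κHat₀ := lt_min (div_pos hS.φ₁_pos hS.φ₂_pos)
    (lt_min (div_pos hS.φ₃_pos hS.φ₄_pos) (div_pos hφ₅ hS.φ₆_pos))
  set ψ₅ := (1 - 2 * S.ε₅) * (S.φ₇ + S.κHat₀ * S.φ₈) / S.ε₆Low + 1
  have hψ₅_pos : 0 < ψ₅ := by
    have := hS.one_sub_nonneg
    have := hS.φ₇_pos
    have := hS.φ₈_pos
    have := ε₆Low_pos hS
    positivity
  have hκ₆ : 0 < S.κ₆' ψ₅ / (√(n : ℝ) * S.dTilde) :=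
    div_pos (hS.κ₆'_pos hψ₅_pos) (mul_pos (Real.sqrt_pos.2 hS.n_pos) hS.dTilde_pos)
  refine ⟨ψ₅, min (S.κHat₀ / 2) (min (1 / S.φ₁) (S.κ₆' ψ₅ / (√(n : ℝ) * S.dTilde))),
    lt_min (half_pos hκHat) (lt_min (one_div_pos.2 hS.φ₁_pos) hκ₆), fun α hα hlt => ?_⟩
  obtain ⟨hα_half, hα_root, hα_κ₆⟩ : _ ∧ _ ∧ _ := by simpa only [lt_min_iff] using hlt
  refine ⟨hα, lt_min ?_ (lt_min ?_ ?_), ?_⟩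
  · exact EReal.coe_lt_coe (hα_half.trans (half_lt_self hκHat))
  · exact (EReal.coe_lt_coe hα_root).trans_le (inv_φ₁_le_κ₅ hS)
  · exact EReal.coe_lt_coe hα_κ₆
  · exact (ψ₅Low_le hS hα hα_half.le).trans_lt (lt_add_one _)

end ExistsAdmissible

namespace Admissible

variable {α ψ₅ : ℝ} (ha : S.Admissible α ψ₅)
include ha

lemma pos : 0 < α := ha.1

lemma lt_κHat₀ : α < S.κHat₀ := EReal.coe_lt_coe_iff.1 (ha.2.1.trans_le (min_le_left _ _))

lemma mul_φ₂_lt (hS : S.Regular) : α * S.φ₂ < S.φ₁ :=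
  (lt_div_iff₀ hS.φ₂_pos).1 (ha.lt_κHat₀.trans_le (min_le_left _ _))

lemma mul_φ₄_lt (hS : S.Regular) : α * S.φ₄ < S.φ₃ :=
  (lt_div_iff₀ hS.φ₄_pos).1 (ha.lt_κHat₀.trans_le ((min_le_right _ _).trans (min_le_left _ _)))

lemma gains (hS : S.Regular) : S.Gains where
  toRegular := hS
  φ₁_pos := (mul_pos ha.pos hS.φ₂_pos).trans (ha.mul_φ₂_lt hS)
  φ₃_pos := (mul_pos ha.pos hS.φ₄_pos).trans (ha.mul_φ₄_lt hS)

lemma mul_ε₃_lt_one : α * S.ε₃ α < 1 := by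
  by_contra! hge
  have hcont : ContinuousOn (fun t => t * S.ε₃ t) (Set.Icc 0 α) := by
    unfold ε₃
    fun_prop
  obtain ⟨a, ⟨ha0, haα⟩, hroot⟩ := intermediate_value_Icc ha.pos.le hcont
    (show (1 : ℝ) ∈ Set.Icc _ _ from ⟨by simp, hge⟩)
  have ha_pos : 0 < a := ha0.lt_of_ne fun h0 => by simp [← h0] at hroot
  have hκ₅_le : S.κ₅ ≤ (a : EReal) := sInf_le ⟨a, ha_pos, hroot, rfl⟩
  have hκ₅_gt : (α : EReal) < S.κ₅ :=
    ha.2.1.trans_le ((min_le_right _ _).trans (min_le_left _ _))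
  exact haα.not_gt (EReal.coe_lt_coe_iff.1 (hκ₅_gt.trans_le hκ₅_le))

variable (hS : S.Gains)
include hS

lemma mul_φ₆_lt : α * S.φ₆ < S.φ₅ :=
  (lt_div_iff₀ hS.φ₆_pos).1 (ha.lt_κHat₀.trans_le ((min_le_right _ _).trans (min_le_right _ _)))

lemma ε₃_pos : 0 < S.ε₃ α :=
  lt_min (sub_pos.2 (ha.mul_φ₂_lt hS.toRegular)) (sub_pos.2 (ha.mul_φ₄_lt hS.toRegular))

lemma ε₆_pos : 0 < S.ε₆ α :=
  div_pos (lt_min (half_pos hS.ν_pos) (ha.ε₃_pos hS)) (one_pos.trans_le hS.one_le_ε₂)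

lemma mul_ε₆_le_one : α * S.ε₆ α ≤ 1 := by
  have hα := ha.pos
  have hε₂ := hS.one_le_ε₂
  calc α * S.ε₆ α ≤ α * (S.ε₃ α / S.ε₂) := by
        unfold ε₆
        gcongr
        exact min_le_right _ _
    _ ≤ α * S.ε₃ α := by
        gcongr
        exact div_le_self (ha.ε₃_pos hS).le hε₂
    _ ≤ 1 := ha.mul_ε₃_lt_one.le

lemma ψ₅_pos : 0 < ψ₅ :=
  (div_nonneg (mul_nonneg hS.one_sub_nonneg (hS.ψ₂_pos ha.pos).le) (ha.ε₆_pos hS).le).trans_lt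
    ha.2.2

lemma rate_pos : 0 < S.ε₆ α - (1 - 2 * S.ε₅) * S.ψ₂ α * (1 / ψ₅) := by
  have hlow := ha.2.2
  rw [ψ₅Low, div_lt_iff₀ (ha.ε₆_pos hS)] at hlow
  rw [mul_one_div, sub_pos, div_lt_iff₀ (ha.ψ₅_pos hS)]
  linarith

lemma κ₉_lt_one : S.κ₉ α ψ₅ < 1 := by
  rw [κ₉, Real.sqrt_lt' one_pos, one_pow]
  exact sub_lt_self 1 (mul_pos ha.pos (ha.rate_pos hS))

lemma κ₁₀_lt_one : S.κ₁₀ α ψ₅ < 1 := by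
  have hα := ha.pos
  have hn := hS.n_pos
  have hd := hS.dTilde_pos
  have := hS.ε₅_pos
  have hψ := hS.ψ₃_add_ψ₄_mul_pos (ha.ψ₅_pos hS)
  have hlt : α < S.κ₆' ψ₅ / (√(n : ℝ) * S.dTilde) :=
    EReal.coe_lt_coe_iff.1 (ha.2.1.trans_le ((min_le_right _ _).trans (min_le_right _ _)))
  rw [lt_div_iff₀ (by positivity), κ₆', Real.lt_sqrt (by positivity), lt_div_iff₀ hψ, mul_pow,
    mul_pow, Real.sq_sqrt hn.le] at hlt
  rw [κ₁₀, Real.sqrt_lt' one_pos]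
  linarith

end Admissible

end UnifiedCompression.Setting

/-! ### Lyapunov decrease -/

namespace UnifiedCompression.Setting

variable {n d : ℕ} {S : Setting n d}

lemma L_mul_centerMat : S.L * centerMat n = S.L := by
  rw [centerMat, mul_sub, mul_one, L_mul_avgMat, sub_zero]

lemma kron_L_center (x : Stack n d) : kron d S.L (kron d (centerMat n) x) = kron d S.L x := by
  rw [← kron_mul_apply, L_mul_centerMat]

lemma kron_L_center_dual (hgraph : S.UndirectedConnected) {lam : ℝ} (hlam : 0 < lam)
    (w : Stack n d) :
    kron d S.L (kron d (centerMat n * S.dualMat lam) w) = kron d (centerMat n) w := by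
  rw [← kron_mul_apply, ← mul_assoc, L_mul_centerMat, L_mul_dualMat hgraph hlam]

lemma kron_center_dual_L (hgraph : S.UndirectedConnected) {lam : ℝ} (hlam : 0 < lam)
    (w : Stack n d) :
    kron d (centerMat n * S.dualMat lam) (kron d S.L w) = kron d (centerMat n) w := by
  rw [← kron_mul_apply, mul_assoc, dualMat_mul_L hgraph hlam, kron_mul_apply,
    kron_centerMat_of_mem (kron_centerMat_mem w)]

lemma kron_center_dual_mem (lam : ℝ) (w : Stack n d) :
    kron d (centerMat n * S.dualMat lam) w ∈ zeroAvg n d := by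
  rw [kron_mul_apply]
  exact kron_centerMat_mem _

variable (S) in
/-- The dual variable `E F (v + γ⁻¹ ∇f(1 ⊗ x̄))`, which vanishes exactly when the integral term
compensates the disagreement of the local gradients at the average. -/
def dualVec (lam : ℝ) (x v : Stack n d) : Stack n d :=
  kron d (centerMat n * S.dualMat lam) (v + S.γ⁻¹ • S.grad (kron d (avgMat n) x))

variable (S) in
/-- The energy of the dual variable in the seminorm of the Laplacian. -/
def dualEnergy (lam : ℝ) (x v : Stack n d) : ℝ :=
  ⟪S.dualVec lam x v, kron d S.L (S.dualVec lam x v)⟫_ℝ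

variable (S) in
/-- The optimality gap at the average, summed over the agents. -/
def costGap (x : Stack n d) : ℝ := n * (S.F (avg x) - S.fStar)

variable (S) in
/-- The Lyapunov function of the algorithm. -/
def lyapunov (lam : ℝ) (x v : Stack n d) : ℝ :=
  quadLyapunov S.β S.γ (kron d S.L) (kron d (centerMat n) x) (S.dualVec lam x v) + S.costGap x

lemma costGap_nonneg (hopt : S.FiniteOptimum) (x : Stack n d) : 0 ≤ S.costGap x :=
  mul_nonneg n.cast_nonneg (sub_nonneg.2 (fStar_le hopt _))

lemma dualEnergy_nonneg (hn : 2 ≤ n) (hgraph : S.UndirectedConnected) (lam : ℝ)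
    (x v : Stack n d) : 0 ≤ S.dualEnergy lam x v :=
  (spectralBounds_kron_L hn hgraph).inner_nonneg _

lemma norm_dualVec_sq_le (hn : 2 ≤ n) (hgraph : S.UndirectedConnected) (lam : ℝ)
    (x v : Stack n d) : ‖S.dualVec lam x v‖ ^ 2 ≤ S.ρ₂⁻¹ * S.dualEnergy lam x v :=
  (spectralBounds_kron_L hn hgraph).norm_sq_le_inv_mul (kron_center_dual_mem lam _)

lemma lyapunov_eq (hS : S.Gains) (lam : ℝ) (x v : Stack n d) :
    S.lyapunov lam x v = 1 / 2 * ‖kron d (centerMat n) x‖ ^ 2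
      + (1 + S.τ₁) / 2 * S.dualEnergy lam x v
      + ⟪kron d (centerMat n) x, S.dualVec lam x v⟫_ℝ + S.costGap x := by
  have := hS.γ_pos
  have hratio : (S.β + S.γ) / (2 * S.γ) = (1 + S.τ₁) / 2 := by
    unfold β
    field_simp
    ring
  rw [lyapunov, quadLyapunov, hratio, dualEnergy]

lemma le_lyapunov (hn : 2 ≤ n) (hgraph : S.UndirectedConnected) (hS : S.Gains) (lam : ℝ)
    (x v : Stack n d) :
    S.ε₁ * (‖kron d (centerMat n) x‖ ^ 2 + S.dualEnergy lam x v) + S.costGap x ≤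
      S.lyapunov lam x v := by
  have hτ := hS.τ₁_pos
  have hρ₂ := hS.ρ₂_pos
  have hcross := mul_inner_le (k := -1) (s := 1 / (2 * (S.τ₁ * S.ρ₂))) (t := S.τ₁ * S.ρ₂ / 2)
    (by field_simp; norm_num) (by positivity) (by positivity) le_rfl
    (norm_dualVec_sq_le hn hgraph lam x v) (a := kron d (centerMat n) x)
  have hdual : S.τ₁ * S.ρ₂ / 2 * (S.ρ₂⁻¹ * S.dualEnergy lam x v) =
      S.τ₁ / 2 * S.dualEnergy lam x v := by field_simp
  have henergy := mul_le_mul_of_nonneg_right hS.ε₁_le_half (dualEnergy_nonneg hn hgraph lam x v)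
  have hpoint : S.ε₁ * ‖kron d (centerMat n) x‖ ^ 2 =
      (1 / 2 - 1 / (2 * (S.τ₁ * S.ρ₂))) * ‖kron d (centerMat n) x‖ ^ 2 := by rw [hS.ε₁_eq]
  rw [lyapunov_eq hS]
  linarith

lemma lyapunov_le (hn : 2 ≤ n) (hgraph : S.UndirectedConnected) (hopt : S.FiniteOptimum)
    (hS : S.Gains) (lam : ℝ) (x v : Stack n d) :
    S.lyapunov lam x v ≤
      S.ε₂ * (‖kron d (centerMat n) x‖ ^ 2 + S.dualEnergy lam x v + S.costGap x) := by
  have hτ := hS.τ₁_pos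
  have hρ₂ := hS.ρ₂_pos
  have hcross := mul_inner_le (k := 1) (s := S.τ₁ * S.ρ₂ / 2) (t := 1 / (2 * (S.τ₁ * S.ρ₂)))
    (by field_simp; norm_num) (by positivity) (by positivity) le_rfl
    (norm_dualVec_sq_le hn hgraph lam x v) (a := kron d (centerMat n) x)
  have hdual : 1 / (2 * (S.τ₁ * S.ρ₂)) * (S.ρ₂⁻¹ * S.dualEnergy lam x v) =
      1 / (2 * S.τ₁ * S.ρ₂ ^ 2) * S.dualEnergy lam x v := by field_simp
  have hpoint : (1 + S.τ₁ * S.ρ₂) / 2 * ‖kron d (centerMat n) x‖ ^ 2 ≤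
      S.ε₂ * ‖kron d (centerMat n) x‖ ^ 2 := by
    gcongr
    exact le_max_left _ _
  have henergy : ((1 + S.τ₁) / 2 + 1 / (2 * S.τ₁ * S.ρ₂ ^ 2)) * S.dualEnergy lam x v ≤
      S.ε₂ * S.dualEnergy lam x v :=
    mul_le_mul_of_nonneg_right (le_max_right _ _) (dualEnergy_nonneg hn hgraph lam x v)
  have hcost := mul_le_mul_of_nonneg_right hS.one_le_ε₂ (costGap_nonneg hopt x)
  rw [lyapunov_eq hS]
  linarith

variable (S) in
/-- The update of `x` when the compressed estimates are `xh`. -/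
def nextX (α : ℝ) (x v xh : Stack n d) : Stack n d :=
  x - α • (S.β • kron d S.L xh + S.γ • v + S.grad x)

variable (S) in
/-- The update of `v` when the compressed estimates are `xh`. -/
def nextV (α : ℝ) (v xh : Stack n d) : Stack n d := v + (α * S.γ) • kron d S.L xh

lemma avg_nextX (hgraph : S.UndirectedConnected) (α : ℝ) (x xh : Stack n d) {v : Stack n d}
    (hv : avg v = 0) : avg (S.nextX α x v xh) = avg x - α • avg (S.grad x) := by
  rw [nextX, avg_sub, avg_smul, avg_add, avg_add, avg_smul, avg_smul, hv,
    avg_kron_of_avgMat_mul_eq_zero (avgMat_mul_L hgraph), smul_zero, smul_zero, zero_add, zero_add]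

lemma avg_nextV (hgraph : S.UndirectedConnected) (α : ℝ) (xh : Stack n d) {v : Stack n d}
    (hv : avg v = 0) : avg (S.nextV α v xh) = 0 := by
  rw [nextV, avg_add, avg_smul, hv, avg_kron_of_avgMat_mul_eq_zero (avgMat_mul_L hgraph),
    smul_zero, zero_add]

variable (S) in
/-- The change of the dual variable caused by moving the average from that of `x` to that
of `x'`, times `γ`. -/
def dualShift (lam : ℝ) (x x' : Stack n d) : Stack n d :=
  kron d (centerMat n * S.dualMat lam)
    (S.grad (kron d (avgMat n) x') - S.grad (kron d (avgMat n) x))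

lemma norm_kron_L_dualShift_sq_le (hgraph : S.UndirectedConnected) (hs : S.Smooth) {lam : ℝ}
    (hlam : 0 < lam) (x x' : Stack n d) :
    ‖kron d S.L (S.dualShift lam x x')‖ ^ 2 ≤ S.ℓ ^ 2 * (n * ‖avg x' - avg x‖ ^ 2) := by
  rw [dualShift, kron_L_center_dual hgraph hlam]
  refine (norm_center_sq_le _).trans ((norm_grad_sub_sq_le hs _ _).trans_eq ?_)
  rw [← map_sub, norm_kron_avgMat_sq, avg_sub]

lemma norm_kron_L_smul_dualShift_nextX_sq_le (hgraph : S.UndirectedConnected) (hs : S.Smooth)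
    {lam : ℝ} (hlam : 0 < lam) {α : ℝ} (hα : α ≠ 0) (x xh : Stack n d) {v : Stack n d}
    (hv : avg v = 0) :
    ‖kron d S.L (α⁻¹ • S.dualShift lam x (S.nextX α x v xh))‖ ^ 2 ≤
      S.ℓ ^ 2 * (n * ‖avg (S.grad x)‖ ^ 2) :=
  calc ‖kron d S.L (α⁻¹ • S.dualShift lam x (S.nextX α x v xh))‖ ^ 2
      = α⁻¹ ^ 2 * ‖kron d S.L (S.dualShift lam x (S.nextX α x v xh))‖ ^ 2 := by
        rw [map_smul, norm_smul, mul_pow, Real.norm_eq_abs, sq_abs]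
    _ ≤ α⁻¹ ^ 2 * (S.ℓ ^ 2 * (n * ‖avg (S.nextX α x v xh) - avg x‖ ^ 2)) := by
        gcongr
        exact norm_kron_L_dualShift_sq_le hgraph hs hlam _ _
    _ = S.ℓ ^ 2 * (n * ‖avg (S.grad x)‖ ^ 2) := by
        rw [avg_nextX hgraph α x xh hv, sub_sub_cancel_left, norm_neg, norm_smul, mul_pow,
          Real.norm_eq_abs, sq_abs]
        field_simp

lemma center_nextX (hgraph : S.UndirectedConnected) (hγ : S.γ ≠ 0) {lam : ℝ} (hlam : 0 < lam)
    (α : ℝ) (x v xh : Stack n d) :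
    kron d (centerMat n) (S.nextX α x v xh) = kron d (centerMat n) x -
      α • (S.β • kron d S.L (kron d (centerMat n) x - kron d (centerMat n) (x - xh))
        + S.γ • kron d S.L (S.dualVec lam x v)
        + kron d (centerMat n) (S.grad x - S.grad (kron d (avgMat n) x))) := by
  have hcenter_L : kron d (centerMat n) (kron d S.L xh) = kron d S.L xh := by
    rw [← kron_mul_apply, centerMat_mul_L hgraph]
  rw [← map_sub (kron d (centerMat n)), sub_sub_cancel, kron_L_center, dualVec,
    kron_L_center_dual hgraph hlam, nextX]
  simp only [map_sub, map_add, map_smul, hcenter_L, smul_add, smul_sub, smul_inv_smul₀ hγ]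
  abel

lemma dualVec_next (hgraph : S.UndirectedConnected) {lam : ℝ} (hlam : 0 < lam) {α : ℝ}
    (hα : α ≠ 0) (x v xh : Stack n d) :
    S.dualVec lam (S.nextX α x v xh) (S.nextV α v xh) = S.dualVec lam x v
      + (α * S.γ) • (kron d (centerMat n) x - kron d (centerMat n) (x - xh))
      + (α * S.γ⁻¹) • α⁻¹ • S.dualShift lam x (S.nextX α x v xh) := by
  rw [← map_sub (kron d (centerMat n)), sub_sub_cancel, smul_smul, mul_right_comm,
    mul_inv_cancel₀ hα, one_mul, dualVec, dualVec, dualShift, nextV]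
  simp only [map_sub, map_add, map_smul, kron_center_dual_L hgraph hlam, smul_sub]
  abel

lemma norm_center_grad_sub_sq_le (hs : S.Smooth) (x : Stack n d) :
    ‖kron d (centerMat n) (S.grad x - S.grad (kron d (avgMat n) x))‖ ^ 2 ≤
      S.ℓ ^ 2 * ‖kron d (centerMat n) x‖ ^ 2 :=
  (norm_center_sq_le _).trans
    ((norm_grad_sub_sq_le hs _ _).trans_eq (by rw [kron_centerMat x]))

lemma lyapunov_next_le (hn : 2 ≤ n) (hgraph : S.UndirectedConnected) (hs : S.Smooth)
    (hS : S.Gains) {α : ℝ} (hα : 0 < α) (hαφ : α * S.φ₆ ≤ S.φ₅) {lam : ℝ} (hlam : 0 < lam)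
    {x v : Stack n d} (xh : Stack n d) (hv : avg v = 0) :
    S.lyapunov lam (S.nextX α x v xh) (S.nextV α v xh) ≤ S.lyapunov lam x v
      - α * ((S.φ₁ - α * S.φ₂) * ‖kron d (centerMat n) x‖ ^ 2
        + (S.φ₃ - α * S.φ₄) * S.dualEnergy lam x v
        + 1 / 2 * (n * ‖gradient S.F (avg x)‖ ^ 2))
      + α * S.ψ₂ α * ‖x - xh‖ ^ 2 := by
  have hquad := (spectralBounds_kron_L hn hgraph).quadLyapunov_step_le hα.le hS.γ_pos hS.γ_le_mul
    (u := S.dualVec lam x v) (r := α⁻¹ • S.dualShift lam x (S.nextX α x v xh))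
    (kron_centerMat_mem x) (kron_centerMat_mem (x - xh)) (kron_center_dual_mem lam _)
    ((zeroAvg n d).smul_mem α⁻¹ (kron_center_dual_mem lam _)) (norm_center_grad_sub_sq_le hs x)
    (norm_kron_L_smul_dualShift_nextX_sq_le hgraph hs hlam hα.ne' x xh hv)
  rw [← center_nextX hgraph hS.γ_pos.ne' hlam, ← dualVec_next hgraph hlam hα.ne'] at hquad
  have hcost := F_step_le hs hα.le x
  rw [← avg_nextX hgraph α x xh hv] at hcost
  have herror : α * S.ψ₂ α * ‖kron d (centerMat n) (x - xh)‖ ^ 2 ≤ α * S.ψ₂ α * ‖x - xh‖ ^ 2 :=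
    mul_le_mul_of_nonneg_left (norm_center_sq_le _) (mul_pos hα (hS.ψ₂_pos hα)).le
  have hgrad : 0 ≤ α * (S.φ₅ - α * S.φ₆ + 3 / 8) * (n * ‖avg (S.grad x)‖ ^ 2) := by
    have := sub_nonneg.2 hαφ
    positivity
  unfold φ₅ φ₆ at hgrad
  unfold ψ₂ φ₇ φ₈ at herror ⊢
  unfold lyapunov costGap dualEnergy φ₁ φ₂ φ₃ φ₄
  linarith

lemma ε₆_mul_lyapunov_le (hn : 2 ≤ n) (hgraph : S.UndirectedConnected) (hopt : S.FiniteOptimum)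
    (hPL : S.PolyakLojasiewicz) (hS : S.Gains) {α : ℝ} (hα : 0 ≤ S.ε₆ α) (lam : ℝ)
    (x v : Stack n d) :
    S.ε₆ α * S.lyapunov lam x v ≤ (S.φ₁ - α * S.φ₂) * ‖kron d (centerMat n) x‖ ^ 2
      + (S.φ₃ - α * S.φ₄) * S.dualEnergy lam x v + 1 / 2 * (n * ‖gradient S.F (avg x)‖ ^ 2) := by
  have hε₂ := one_pos.trans_le hS.one_le_ε₂
  have henergy := dualEnergy_nonneg hn hgraph lam x v
  have hcost := costGap_nonneg hopt x
  have hPL' : S.ν * S.costGap x ≤ 1 / 2 * (n * ‖gradient S.F (avg x)‖ ^ 2) := by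
    rw [costGap, mul_left_comm, mul_left_comm (1 / 2)]
    exact mul_le_mul_of_nonneg_left (hPL.bound _) n.cast_nonneg
  calc S.ε₆ α * S.lyapunov lam x v
      ≤ S.ε₆ α * (S.ε₂ * (‖kron d (centerMat n) x‖ ^ 2 + S.dualEnergy lam x v + S.costGap x)) := by
        gcongr
        exact lyapunov_le hn hgraph hopt hS lam x v
    _ = min (S.ν / 2) (S.ε₃ α) * ‖kron d (centerMat n) x‖ ^ 2
        + min (S.ν / 2) (S.ε₃ α) * S.dualEnergy lam x v
        + min (S.ν / 2) (S.ε₃ α) * S.costGap x := by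
        unfold ε₆
        field_simp
    _ ≤ (S.φ₁ - α * S.φ₂) * ‖kron d (centerMat n) x‖ ^ 2
        + (S.φ₃ - α * S.φ₄) * S.dualEnergy lam x v + S.ν * S.costGap x := by
        gcongr
        · exact (min_le_right _ _).trans (min_le_left _ _)
        · exact (min_le_right _ _).trans (min_le_right _ _)
        · exact (min_le_left _ _).trans (half_le_self hS.ν_pos.le)
    _ ≤ _ := by gcongr

lemma lyapunov_step_le (hn : 2 ≤ n) (hgraph : S.UndirectedConnected) (hs : S.Smooth)
    (hopt : S.FiniteOptimum) (hPL : S.PolyakLojasiewicz) (hS : S.Gains) {α ψ₅ : ℝ}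
    (ha : S.Admissible α ψ₅) {lam : ℝ} (hlam : 0 < lam) {x v : Stack n d} (xh : Stack n d)
    (hv : avg v = 0) :
    S.lyapunov lam (S.nextX α x v xh) (S.nextV α v xh) ≤
      (1 - α * S.ε₆ α) * S.lyapunov lam x v + α * S.ψ₂ α * ‖x - xh‖ ^ 2 := by
  have hstep := lyapunov_next_le hn hgraph hs hS ha.pos (ha.mul_φ₆_lt hS).le hlam (x := x) xh hv
  have hdecay := mul_le_mul_of_nonneg_left
    (ε₆_mul_lyapunov_le hn hgraph hopt hPL hS (ha.ε₆_pos hS).le lam x v) ha.pos.le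
  linarith

end UnifiedCompression.Setting

/-! ### Compression and linear convergence -/

namespace UnifiedCompression

lemma add_sq_le_one_add_mul {c : ℝ} (hc : 0 < c) (a b : ℝ) :
    (a + b) ^ 2 ≤ (1 + c) * a ^ 2 + (1 + c⁻¹) * b ^ 2 := by
  have hsq : 0 ≤ c⁻¹ * (c * a - b) ^ 2 := by positivity
  have hexpand : c⁻¹ * (c * a - b) ^ 2 = c * a ^ 2 - 2 * a * b + c⁻¹ * b ^ 2 := by
    field_simp
    ring
  linarith

namespace Setting

variable {n d : ℕ} {S : Setting n d}

lemma nextX_sub (α : ℝ) (x v xh : Stack n d) :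
    S.nextX α x v xh - x = (-α) •
      (S.β • kron d S.L (kron d (centerMat n) x) - S.β • kron d S.L (x - xh)
        + (S.γ • v + S.grad (kron d (avgMat n) x)
          + (S.grad x - S.grad (kron d (avgMat n) x)))) := by
  rw [kron_L_center, nextX, map_sub]
  module

lemma norm_smul_add_grad_sq_le (hn : 2 ≤ n) (hgraph : S.UndirectedConnected) (hs : S.Smooth)
    (hopt : S.FiniteOptimum) (hγ : S.γ ≠ 0) {lam : ℝ} (hlam : 0 < lam) (x : Stack n d)
    {v : Stack n d} (hv : avg v = 0) :
    ‖S.γ • v + S.grad (kron d (avgMat n) x)‖ ^ 2 ≤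
      S.γ ^ 2 * S.ρ * S.dualEnergy lam x v + 2 * S.ℓ * S.costGap x := by
  have hcenter : kron d (centerMat n) (S.γ • v + S.grad (kron d (avgMat n) x)) =
      S.γ • kron d S.L (S.dualVec lam x v) := by
    rw [dualVec, kron_L_center_dual hgraph hlam, ← map_smul, smul_add, smul_inv_smul₀ hγ]
  have havg : avg (S.γ • v + S.grad (kron d (avgMat n) x)) = gradient S.F (avg x) := by
    rw [avg_add, avg_smul, hv, smul_zero, zero_add, avg_grad_kron_avgMat hs]
  rw [norm_sq_eq_center_add_avg, hcenter, havg, norm_smul, mul_pow, Real.norm_eq_abs, sq_abs,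
    mul_assoc (S.γ ^ 2), costGap, mul_left_comm (2 * S.ℓ)]
  gcongr
  · exact (spectralBounds_kron_L hn hgraph).norm_sq_le _
  · exact norm_gradient_sq_le hs.ℓ_pos (differentiable_F hs) (gradient_F_lipschitz hs)
      (fStar_le hopt) _

lemma two_mul_ℓ_le (hS : S.Gains) : 2 * S.ℓ ≤ S.β ^ 2 * S.ρ ^ 2 + S.ℓ ^ 2 := by
  have hone : 1 ≤ S.β * S.ρ := by
    have hφ₁ := hS.φ₁_pos
    have hρ := mul_le_mul_of_nonneg_right hS.ρ₂_le_ρ hS.β_pos.le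
    unfold φ₁ at hφ₁
    linarith [hS.γ_pos, sq_nonneg S.ℓ]
  calc 2 * S.ℓ ≤ 2 * (S.β * S.ρ) * S.ℓ := by
        have := hS.ℓ_pos
        gcongr
        linarith
    _ ≤ (S.β * S.ρ) ^ 2 + S.ℓ ^ 2 := two_mul_le_add_sq _ _
    _ = S.β ^ 2 * S.ρ ^ 2 + S.ℓ ^ 2 := by rw [mul_pow]

lemma step_terms_le_lyapunov (hn : 2 ≤ n) (hgraph : S.UndirectedConnected)
    (hopt : S.FiniteOptimum) (hS : S.Gains) (lam : ℝ) (x v : Stack n d) :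
    (S.β ^ 2 * S.ρ ^ 2 + S.ℓ ^ 2) * ‖kron d (centerMat n) x‖ ^ 2
        + S.γ ^ 2 * S.ρ * S.dualEnergy lam x v + 2 * S.ℓ * S.costGap x ≤
      max (S.β ^ 2 * S.ρ ^ 2 + S.ℓ ^ 2) (S.γ ^ 2 * S.ρ) / S.ε₁ * S.lyapunov lam x v := by
  set M := max (S.β ^ 2 * S.ρ ^ 2 + S.ℓ ^ 2) (S.γ ^ 2 * S.ρ)
  have hε₁ := hS.ε₁_pos
  have hcost := costGap_nonneg hopt x
  have henergy := dualEnergy_nonneg hn hgraph lam x v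
  have : 0 ≤ M := le_max_of_le_left (by positivity)
  have hcost_le : S.ε₁ * S.costGap x ≤ S.costGap x :=
    mul_le_of_le_one_left hcost (hS.ε₁_le_half.trans (by norm_num))
  calc _ ≤ M * ‖kron d (centerMat n) x‖ ^ 2 + M * S.dualEnergy lam x v + M * S.costGap x := by
        gcongr
        · exact le_max_left _ _
        · exact le_max_right _ _
        · exact (two_mul_ℓ_le hS).trans (le_max_left _ _)
    _ = M / S.ε₁ * (S.ε₁ * (‖kron d (centerMat n) x‖ ^ 2 + S.dualEnergy lam x v)
        + S.ε₁ * S.costGap x) := by field_simp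
    _ ≤ M / S.ε₁ * S.lyapunov lam x v := by
        gcongr
        linarith [le_lyapunov hn hgraph hS lam x v]

lemma norm_nextX_sub_sq_le (hn : 2 ≤ n) (hgraph : S.UndirectedConnected) (hs : S.Smooth)
    (hopt : S.FiniteOptimum) (hS : S.Gains) (α : ℝ) {lam : ℝ} (hlam : 0 < lam) (x : Stack n d)
    {v : Stack n d} (xh : Stack n d) (hv : avg v = 0) :
    ‖S.nextX α x v xh - x‖ ^ 2 ≤ 4 * α ^ 2 * (S.β ^ 2 * S.ρ ^ 2 * ‖x - xh‖ ^ 2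
      + max (S.β ^ 2 * S.ρ ^ 2 + S.ℓ ^ 2) (S.γ ^ 2 * S.ρ) / S.ε₁ * S.lyapunov lam x v) := by
  have hL (z : Stack n d) : ‖S.β • kron d S.L z‖ ^ 2 ≤ S.β ^ 2 * S.ρ ^ 2 * ‖z‖ ^ 2 := by
    rw [norm_smul, mul_pow, Real.norm_eq_abs, sq_abs, mul_assoc, ← mul_pow S.ρ]
    gcongr
    exact (spectralBounds_kron_L hn hgraph).norm_le z
  have hsplit := norm_add_sq_le_two_mul
    (S.β • kron d S.L (kron d (centerMat n) x) - S.β • kron d S.L (x - xh))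
    (S.γ • v + S.grad (kron d (avgMat n) x) + (S.grad x - S.grad (kron d (avgMat n) x)))
  have hconsensus := norm_sub_sq_le_two_mul (S.β • kron d S.L (kron d (centerMat n) x))
    (S.β • kron d S.L (x - xh))
  have hgradient := norm_add_sq_le_two_mul (S.γ • v + S.grad (kron d (avgMat n) x))
    (S.grad x - S.grad (kron d (avgMat n) x))
  have hdual := norm_smul_add_grad_sq_le hn hgraph hs hopt hS.γ_pos.ne' hlam x hv
  have hlocal := norm_grad_sub_sq_le hs x (kron d (avgMat n) x)
  rw [← kron_centerMat] at hlocal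
  have hlyap := step_terms_le_lyapunov hn hgraph hopt hS lam x v
  rw [nextX_sub, norm_smul, mul_pow, Real.norm_eq_abs, sq_abs, neg_sq, mul_comm 4, mul_assoc]
  gcongr
  linarith [hL (kron d (centerMat n) x), hL (x - xh)]

lemma lpNorm_sub_smul_comp_le (hcomp : S.LocallyBounded) (hω : 0 ≤ S.ω) (hω' : S.ω ≤ 1 / S.r)
    {u : Vec d} (hu : lpNorm S.p u ≤ S.C) :
    lpNorm S.p (u - S.ω • S.comp u) ≤ S.C * (1 - S.ω * S.r * S.δ) := by
  have : Fact (1 ≤ S.p) := ⟨hcomp.one_le_p⟩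
  have hr := hcomp.r_pos
  have hωr : 0 ≤ S.ω * S.r := mul_nonneg hω hr.le
  have hωr' : 0 ≤ 1 - S.ω * S.r := sub_nonneg.2 ((le_div_iff₀ hr).1 hω')
  have hconvex : u - S.ω • S.comp u =
      (1 - S.ω * S.r) • u + (-(S.ω * S.r)) • (S.r⁻¹ • S.comp u - u) := by
    rw [smul_sub, smul_smul, neg_mul, mul_assoc, mul_inv_cancel₀ hr.ne']
    module
  calc lpNorm S.p (u - S.ω • S.comp u)
      ≤ (1 - S.ω * S.r) * lpNorm S.p u
        + S.ω * S.r * lpNorm S.p (S.r⁻¹ • S.comp u - u) := by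
        rw [hconvex]
        refine (lpNorm_add_le _ _).trans_eq ?_
        rw [lpNorm_smul, lpNorm_smul, abs_neg, abs_of_nonneg hωr, abs_of_nonneg hωr']
    _ ≤ (1 - S.ω * S.r) * S.C + S.ω * S.r * (S.C * (1 - S.δ)) := by
        gcongr
        exact hcomp.bound u hu
    _ = S.C * (1 - S.ω * S.r * S.δ) := by ring

lemma sq_one_sub_le_one_sub_two_mul_ε₅ (hr : 0 < S.r) (hω : 0 ≤ S.ω) (hω' : S.ω ≤ 1 / S.r) :
    (1 - S.ω * S.r * S.δ) ^ 2 ≤ 1 - 2 * S.ε₅ := by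
  have : 0 ≤ S.ω * S.r := mul_nonneg hω hr.le
  have hωr' : 0 ≤ 1 - S.ω * S.r := sub_nonneg.2 ((le_div_iff₀ hr).1 hω')
  have hgap : 0 ≤ S.ω * S.r * (1 - S.ω * S.r) * S.δ ^ 2 := by positivity
  unfold ε₅
  linarith

lemma lpNorm_compress_sq_le (hcomp : S.LocallyBounded) (hω : 0 ≤ S.ω) (hω' : S.ω ≤ 1 / S.r)
    {s : ℝ} (hs : 0 < s) {z : Vec d} (hz : lpNorm S.p z ≤ S.C * s) :
    lpNorm S.p (z - (S.ω * s) • S.comp (s⁻¹ • z)) ^ 2 ≤ (1 - 2 * S.ε₅) * (S.C ^ 2 * s ^ 2) := by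
  have : Fact (1 ≤ S.p) := ⟨hcomp.one_le_p⟩
  have hscale : z - (S.ω * s) • S.comp (s⁻¹ • z) =
      s • (s⁻¹ • z - S.ω • S.comp (s⁻¹ • z)) := by
    rw [smul_sub, smul_inv_smul₀ hs.ne', smul_smul, mul_comm s]
  have hunit : lpNorm S.p (s⁻¹ • z) ≤ S.C := by
    rwa [lpNorm_smul, abs_of_pos (inv_pos.2 hs), inv_mul_le_iff₀' hs]
  calc lpNorm S.p (z - (S.ω * s) • S.comp (s⁻¹ • z)) ^ 2
      = s ^ 2 * lpNorm S.p (s⁻¹ • z - S.ω • S.comp (s⁻¹ • z)) ^ 2 := by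
        rw [hscale, lpNorm_smul, mul_pow, sq_abs]
    _ ≤ s ^ 2 * (S.C * (1 - S.ω * S.r * S.δ)) ^ 2 := by
        gcongr
        · exact lpNorm_nonneg _
        · exact lpNorm_sub_smul_comp_le hcomp hω hω' hunit
    _ = (1 - S.ω * S.r * S.δ) ^ 2 * (S.C ^ 2 * s ^ 2) := by ring
    _ ≤ (1 - 2 * S.ε₅) * (S.C ^ 2 * s ^ 2) := by
        gcongr
        exact sq_one_sub_le_one_sub_two_mul_ε₅ hcomp.r_pos hω hω'

lemma norm_sq_le_of_lpNorm_sq_le [Fact (1 ≤ S.p)] {z : Stack n d} {B : ℝ}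
    (hz : ∀ i, lpNorm S.p (z i) ^ 2 ≤ B) : ‖z‖ ^ 2 ≤ n * (S.dTilde ^ 2 * B) := by
  calc ‖z‖ ^ 2 = ∑ i, ‖z i‖ ^ 2 := PiLp.norm_sq_eq_of_L2 _ _
    _ ≤ ∑ _i : Fin n, S.dTilde ^ 2 * B := by
        gcongr with i
        calc ‖z i‖ ^ 2 ≤ (S.dTilde * lpNorm S.p (z i)) ^ 2 := by
              gcongr
              exact S.norm_le_dTilde_mul _
          _ = S.dTilde ^ 2 * lpNorm S.p (z i) ^ 2 := mul_pow _ _ _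
          _ ≤ S.dTilde ^ 2 * B := by gcongr; exact hz i
    _ = n * (S.dTilde ^ 2 * B) := by
        rw [Finset.sum_const, Finset.card_univ, Fintype.card_fin, nsmul_eq_mul]

lemma lpNorm_apply_sq_le [Fact (1 ≤ S.p)] (hd : 0 ≤ S.dHat) (z : Stack n d) (i : Fin n) :
    lpNorm S.p (z i) ^ 2 ≤ S.dHat ^ 2 * ‖z‖ ^ 2 := by
  rw [← mul_pow]
  gcongr
  · exact lpNorm_nonneg _
  · exact (S.lpNorm_le_dHat_mul _).trans (by gcongr; exact PiLp.norm_apply_le z i)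

lemma stack_step_y {z : State n d} (hy : stack z.y = kron d S.L (stack z.xhat)) (α s : ℝ) :
    stack (S.step α s z).y = kron d S.L (stack (S.step α s z).xhat) := by
  have hxhat : stack (S.step α s z).xhat = stack z.xhat +
      (S.ω * s) • stack (fun i => S.comp (s⁻¹ • (z.x i - z.xhat i))) := rfl
  rw [hxhat, map_add, map_smul, ← hy]
  rfl

lemma stack_step_x {z : State n d} (hy : stack z.y = kron d S.L (stack z.xhat)) (α s : ℝ) :
    stack (S.step α s z).x =
      S.nextX α (stack z.x) (stack z.v) (stack (S.step α s z).xhat) := by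
  rw [nextX, ← stack_step_y hy]
  rfl

lemma stack_step_v {z : State n d} (hy : stack z.y = kron d S.L (stack z.xhat)) (α s : ℝ) :
    stack (S.step α s z).v = S.nextV α (stack z.v) (stack (S.step α s z).xhat) := by
  rw [nextV, ← stack_step_y hy]
  rfl

variable (S) in
/-- The invariant of the iteration at scale `s`: every agent's input to the compressor lies in
the region where the compressor is accurate, and the Lyapunov function is of order `s ^ 2`. -/
structure Invariant (ψ₅ lam s : ℝ) (z : State n d) : Prop where
  y_eq : stack z.y = kron d S.L (stack z.xhat)
  avg_v : avg z.v = 0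
  lyapunov_le : S.lyapunov lam (stack z.x) (stack z.v) ≤
    n * S.dTilde ^ 2 * ψ₅ * S.C ^ 2 * s ^ 2
  lpNorm_le : ∀ i, lpNorm S.p (z.x i - z.xhat i) ≤ S.C * s

namespace Invariant

variable {ψ₅ lam s : ℝ} {z : State n d}

lemma lpNorm_sub_step_xhat_sq_le (hz : S.Invariant ψ₅ lam s z) (hcomp : S.LocallyBounded)
    (hω : 0 ≤ S.ω) (hω' : S.ω ≤ 1 / S.r) (hs : 0 < s) (α : ℝ) (i : Fin n) :
    lpNorm S.p (z.x i - (S.step α s z).xhat i) ^ 2 ≤ (1 - 2 * S.ε₅) * (S.C ^ 2 * s ^ 2) := by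
  have hcompress := lpNorm_compress_sq_le hcomp hω hω' hs (hz.lpNorm_le i)
  rwa [sub_sub] at hcompress

lemma norm_sub_step_xhat_sq_le (hz : S.Invariant ψ₅ lam s z) (hcomp : S.LocallyBounded)
    (hω : 0 ≤ S.ω) (hω' : S.ω ≤ 1 / S.r) (hs : 0 < s) (α : ℝ) :
    ‖stack z.x - stack (S.step α s z).xhat‖ ^ 2 ≤
      n * (S.dTilde ^ 2 * ((1 - 2 * S.ε₅) * (S.C ^ 2 * s ^ 2))) :=
  have : Fact (1 ≤ S.p) := ⟨hcomp.one_le_p⟩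
  norm_sq_le_of_lpNorm_sq_le (hz.lpNorm_sub_step_xhat_sq_le hcomp hω hω' hs α)

lemma lyapunov_step_le_κ₉ (hz : S.Invariant ψ₅ lam s z) (hn : 2 ≤ n) (hcomp : S.LocallyBounded)
    (hgraph : S.UndirectedConnected) (hsmooth : S.Smooth) (hopt : S.FiniteOptimum)
    (hPL : S.PolyakLojasiewicz) (hS : S.Gains) (hω : 0 ≤ S.ω) (hω' : S.ω ≤ 1 / S.r) {α : ℝ}
    (ha : S.Admissible α ψ₅) (hlam : 0 < lam) (hs : 0 < s) {ε : ℝ} (hε : S.κ₉ α ψ₅ < ε) :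
    S.lyapunov lam (stack (S.step α s z).x) (stack (S.step α s z).v) ≤
      n * S.dTilde ^ 2 * ψ₅ * S.C ^ 2 * (s * ε) ^ 2 := by
  have hε₀ : 0 < ε := (Real.sqrt_nonneg _).trans_lt hε
  have hψ₅ := ha.ψ₅_pos hS
  have hψ₂ := hS.ψ₂_pos ha.pos
  have hα := ha.pos
  have hrate : 1 - α * (S.ε₆ α - (1 - 2 * S.ε₅) * S.ψ₂ α * (1 / ψ₅)) ≤ ε ^ 2 :=
    ((Real.sqrt_lt' hε₀).1 hε).le
  rw [stack_step_x hz.y_eq, stack_step_v hz.y_eq]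
  refine (lyapunov_step_le hn hgraph hsmooth hopt hPL hS ha hlam
    (stack (S.step α s z).xhat) hz.avg_v).trans ?_
  calc (1 - α * S.ε₆ α) * S.lyapunov lam (stack z.x) (stack z.v)
        + α * S.ψ₂ α * ‖stack z.x - stack (S.step α s z).xhat‖ ^ 2
      ≤ (1 - α * S.ε₆ α) * (n * S.dTilde ^ 2 * ψ₅ * S.C ^ 2 * s ^ 2)
        + α * S.ψ₂ α * (n * (S.dTilde ^ 2 * ((1 - 2 * S.ε₅) * (S.C ^ 2 * s ^ 2)))) := by
        gcongr
        · exact sub_nonneg.2 (ha.mul_ε₆_le_one hS)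
        · exact hz.lyapunov_le
        · exact hz.norm_sub_step_xhat_sq_le hcomp hω hω' hs α
    _ = n * S.dTilde ^ 2 * ψ₅ * S.C ^ 2 * s ^ 2 *
        (1 - α * (S.ε₆ α - (1 - 2 * S.ε₅) * S.ψ₂ α * (1 / ψ₅))) := by
        linear_combination (-(α * S.ψ₂ α * n * S.dTilde ^ 2 * (1 - 2 * S.ε₅) * S.C ^ 2 * s ^ 2))
          * mul_one_div_cancel hψ₅.ne'
    _ ≤ n * S.dTilde ^ 2 * ψ₅ * S.C ^ 2 * s ^ 2 * ε ^ 2 := by gcongr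
    _ = n * S.dTilde ^ 2 * ψ₅ * S.C ^ 2 * (s * ε) ^ 2 := by ring

lemma norm_step_x_sub_sq_le (hz : S.Invariant ψ₅ lam s z) (hn : 2 ≤ n)
    (hcomp : S.LocallyBounded) (hgraph : S.UndirectedConnected) (hsmooth : S.Smooth)
    (hopt : S.FiniteOptimum) (hS : S.Gains) (hω : 0 ≤ S.ω) (hω' : S.ω ≤ 1 / S.r)
    (hlam : 0 < lam) (hs : 0 < s) (α : ℝ) :
    (1 + S.ε₅⁻¹) * (S.dHat ^ 2 * ‖stack (S.step α s z).x - stack z.x‖ ^ 2) ≤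
      α ^ 2 * n * S.dTilde ^ 2 * ((1 - 2 * S.ε₅) * S.ψ₃ + S.ψ₄ * ψ₅) * (S.C ^ 2 * s ^ 2) := by
  have hε₅ := hS.ε₅_pos
  have hε₁ := hS.ε₁_pos
  have : 0 ≤ max (S.β ^ 2 * S.ρ ^ 2 + S.ℓ ^ 2) (S.γ ^ 2 * S.ρ) :=
    le_max_of_le_left (by positivity)
  rw [stack_step_x hz.y_eq]
  calc _ ≤ (1 + S.ε₅⁻¹) * (S.dHat ^ 2 * (4 * α ^ 2 * (S.β ^ 2 * S.ρ ^ 2 *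
          (n * (S.dTilde ^ 2 * ((1 - 2 * S.ε₅) * (S.C ^ 2 * s ^ 2))))
        + max (S.β ^ 2 * S.ρ ^ 2 + S.ℓ ^ 2) (S.γ ^ 2 * S.ρ) / S.ε₁ *
          (n * S.dTilde ^ 2 * ψ₅ * S.C ^ 2 * s ^ 2)))) := by
        gcongr
        refine (norm_nextX_sub_sq_le hn hgraph hsmooth hopt hS α hlam _ _ hz.avg_v).trans ?_
        gcongr
        · exact hz.norm_sub_step_xhat_sq_le hcomp hω hω' hs α
        · exact hz.lyapunov_le
    _ = _ := by
        unfold ψ₃ ψ₄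
        ring

lemma lpNorm_step_le_κ₁₀ (hz : S.Invariant ψ₅ lam s z) (hn : 2 ≤ n) (hcomp : S.LocallyBounded)
    (hgraph : S.UndirectedConnected) (hsmooth : S.Smooth) (hopt : S.FiniteOptimum)
    (hS : S.Gains) (hω : 0 ≤ S.ω) (hω' : S.ω ≤ 1 / S.r) (hlam : 0 < lam) (hs : 0 < s) {α ε : ℝ}
    (hε : S.κ₁₀ α ψ₅ < ε) (i : Fin n) :
    lpNorm S.p ((S.step α s z).x i - (S.step α s z).xhat i) ≤ S.C * (s * ε) := by
  have : Fact (1 ≤ S.p) := ⟨hcomp.one_le_p⟩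
  have hε₀ : 0 < ε := (Real.sqrt_nonneg _).trans_lt hε
  have hC := hcomp.C_pos
  have hε₅ := hS.ε₅_pos
  have hrate : 1 - (S.ε₅ + 2 * S.ε₅ ^ 2)
      + α ^ 2 * n * S.dTilde ^ 2 * ((1 - 2 * S.ε₅) * S.ψ₃ + S.ψ₄ * ψ₅) ≤ ε ^ 2 :=
    ((Real.sqrt_lt' hε₀).1 hε).le
  set z' := S.step α s z
  have hcompress := hz.lpNorm_sub_step_xhat_sq_le hcomp hω hω' hs α i
  have hmove : (1 + S.ε₅⁻¹) * lpNorm S.p (z'.x i - z.x i) ^ 2 ≤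
      α ^ 2 * n * S.dTilde ^ 2 * ((1 - 2 * S.ε₅) * S.ψ₃ + S.ψ₄ * ψ₅) * (S.C ^ 2 * s ^ 2) :=
    (mul_le_mul_of_nonneg_left
      (lpNorm_apply_sq_le hS.dHat_pos.le (stack z'.x - stack z.x) i) (by positivity)).trans
      (hz.norm_step_x_sub_sq_le hn hcomp hgraph hsmooth hopt hS hω hω' hlam hs α)
  refine (abs_le_of_sq_le_sq' ?_ (by positivity)).2
  calc lpNorm S.p (z'.x i - z'.xhat i) ^ 2
      ≤ (lpNorm S.p (z.x i - z'.xhat i) + lpNorm S.p (z'.x i - z.x i)) ^ 2 := by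
        gcongr
        · exact lpNorm_nonneg _
        · rw [← sub_add_sub_cancel' (z.x i)]
          exact lpNorm_add_le _ _
    _ ≤ (1 + S.ε₅) * lpNorm S.p (z.x i - z'.xhat i) ^ 2
        + (1 + S.ε₅⁻¹) * lpNorm S.p (z'.x i - z.x i) ^ 2 :=
        add_sq_le_one_add_mul hε₅ _ _
    _ ≤ (1 + S.ε₅) * ((1 - 2 * S.ε₅) * (S.C ^ 2 * s ^ 2)) + α ^ 2 * n * S.dTilde ^ 2 *
          ((1 - 2 * S.ε₅) * S.ψ₃ + S.ψ₄ * ψ₅) * (S.C ^ 2 * s ^ 2) := by gcongr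
    _ = (1 - (S.ε₅ + 2 * S.ε₅ ^ 2) + α ^ 2 * n * S.dTilde ^ 2 *
          ((1 - 2 * S.ε₅) * S.ψ₃ + S.ψ₄ * ψ₅)) * (S.C ^ 2 * s ^ 2) := by ring
    _ ≤ ε ^ 2 * (S.C ^ 2 * s ^ 2) := by gcongr
    _ = (S.C * (s * ε)) ^ 2 := by ring

lemma step (hz : S.Invariant ψ₅ lam s z) (hn : 2 ≤ n) (hcomp : S.LocallyBounded)
    (hgraph : S.UndirectedConnected) (hsmooth : S.Smooth) (hopt : S.FiniteOptimum)
    (hPL : S.PolyakLojasiewicz) (hS : S.Gains) (hω : 0 ≤ S.ω) (hω' : S.ω ≤ 1 / S.r) {α : ℝ}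
    (ha : S.Admissible α ψ₅) (hlam : 0 < lam) (hs : 0 < s) {ε : ℝ}
    (hε : max (S.κ₉ α ψ₅) (S.κ₁₀ α ψ₅) < ε) :
    S.Invariant ψ₅ lam (s * ε) (S.step α s z) where
  y_eq := stack_step_y hz.y_eq α s
  avg_v := by
    have havg := avg_nextV hgraph α (stack (S.step α s z).xhat) (v := stack z.v) hz.avg_v
    rwa [← stack_step_v hz.y_eq] at havg
  lyapunov_le := hz.lyapunov_step_le_κ₉ hn hcomp hgraph hsmooth hopt hPL hS hω hω' ha hlam hs
    ((le_max_left _ _).trans_lt hε)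
  lpNorm_le := hz.lpNorm_step_le_κ₁₀ hn hcomp hgraph hsmooth hopt hS hω hω' hlam hs
    ((le_max_right _ _).trans_lt hε)

end Invariant

lemma inner_kron_centerMat_mul_dualMat_le (hgraph : S.UndirectedConnected) {lam : ℝ}
    (hlam : 0 < lam) (w : Stack n d) :
    ⟪w, kron d (centerMat n * S.dualMat lam) w⟫_ℝ ≤ stackedForm (S.dualMat lam) w w := by
  have havg : ⟪w, kron d (avgMat n) w⟫_ℝ = ‖kron d (avgMat n) w‖ ^ 2 := by
    rw [← real_inner_self_eq_norm_sq, kron_isSymmetric avgMat_transpose, ← kron_mul_apply,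
      avgMat_mul_avgMat]
  have hdual : avgMat n * S.dualMat lam = lam⁻¹ • avgMat n := by
    rw [eq_inv_smul_iff₀ hlam.ne', smul_avgMat_mul_dualMat hgraph hlam]
  rw [centerMat, sub_mul, one_mul, map_sub, LinearMap.sub_apply, inner_sub_right,
    inner_kron_eq_stackedForm, hdual, map_smul, LinearMap.smul_apply, real_inner_smul_right, havg]
  exact sub_le_self _ (by positivity)

lemma dualEnergy_le (hgraph : S.UndirectedConnected) {lam : ℝ} (hlam : 0 < lam)
    {x v w : Stack n d} (hw : v + S.γ⁻¹ • S.grad (kron d (avgMat n) x) = w) :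
    S.dualEnergy lam x v ≤ stackedForm (S.dualMat lam) w w := by
  rw [dualEnergy, dualVec, hw, kron_L_center_dual hgraph hlam,
    ← kron_isSymmetric centerMat_transpose, kron_centerMat_of_mem (kron_center_dual_mem lam _),
    real_inner_comm]
  exact inner_kron_centerMat_mul_dualMat_le hgraph hlam _

lemma costGap_le (hPL : S.PolyakLojasiewicz) (x : Stack n d) :
    S.costGap x ≤ 1 / (2 * S.ν) * (n * ‖gradient S.F (avg x)‖ ^ 2) := by
  have hν := hPL.ν_pos
  calc S.costGap x = n / S.ν * (S.ν * (S.F (avg x) - S.fStar)) := by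
        rw [costGap]
        field_simp
    _ ≤ n / S.ν * (1 / 2 * ‖gradient S.F (avg x)‖ ^ 2) := by
        exact mul_le_mul_of_nonneg_left (hPL.bound _) (by positivity)
    _ = 1 / (2 * S.ν) * (n * ‖gradient S.F (avg x)‖ ^ 2) := by field_simp

lemma lyapunov_zero_le_κν (hgraph : S.UndirectedConnected) (hPL : S.PolyakLojasiewicz)
    (hS : S.Gains) {lam : ℝ} (hlam : 0 < lam) (x₀ : Fin n → Vec d) :
    S.lyapunov lam (stack x₀) 0 ≤ S.κν lam x₀ := by
  have hγ := hS.γ_pos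
  have hβ := hS.β_pos
  set w : Stack n d := stack fun i => S.γ⁻¹ • gradient (S.f i) (avg x₀) with hw_def
  have hw : 0 + S.γ⁻¹ • S.grad (kron d (avgMat n) (stack x₀)) = w := by
    rw [zero_add]
    ext i : 1
    simp only [hw_def, grad, PiLp.smul_apply, kron_avgMat_apply]
  have hcenter : ‖kron d (centerMat n) (stack x₀)‖ ^ 2 = stackedForm (centerMat n) x₀ x₀ := by
    rw [← real_inner_self_eq_norm_sq, kron_isSymmetric centerMat_transpose,
      kron_centerMat_of_mem (kron_centerMat_mem _), inner_kron_eq_stackedForm]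
  have hcross : ⟪kron d (centerMat n) (stack x₀), S.dualVec lam (stack x₀) 0⟫_ℝ =
      stackedForm (centerMat n * S.dualMat lam) x₀ w := by
    rw [dualVec, hw, kron_isSymmetric centerMat_transpose,
      kron_centerMat_of_mem (kron_center_dual_mem lam _), inner_kron_eq_stackedForm]
  have henergy : (S.β + S.γ) / (2 * S.γ) * S.dualEnergy lam (stack x₀) 0 ≤
      1 / 2 * ((S.β + S.γ) / S.γ * stackedForm (S.dualMat lam) w w) := by
    calc _ ≤ (S.β + S.γ) / (2 * S.γ) * stackedForm (S.dualMat lam) w w := by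
          gcongr
          exact dualEnergy_le hgraph hlam hw
      _ = _ := by field_simp
  rw [lyapunov, quadLyapunov, ← dualEnergy, hcenter, hcross, κν]
  gcongr
  exact costGap_le hPL _

lemma invariant_run_zero (hcomp : S.LocallyBounded) (hgraph : S.UndirectedConnected)
    (hPL : S.PolyakLojasiewicz) (hS : S.Gains) {ψ₅ : ℝ} (hψ₅ : 0 < ψ₅) {lam : ℝ}
    (hlam : 0 < lam) {x₀ : Fin n → Vec d} {s₀ : ℝ}
    (hs₀ : max (√(S.κν lam x₀ / (n * S.dTilde ^ 2 * ψ₅ * S.C ^ 2)))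
      ((⨆ i, lpNorm S.p (x₀ i)) / S.C) ≤ s₀) (α : ℝ) (s : ℕ → ℝ) :
    S.Invariant ψ₅ lam s₀ (S.run α s x₀ 0) where
  y_eq := (map_zero (kron d S.L)).symm
  avg_v := by simp only [run, avg, Pi.zero_apply, Finset.sum_const_zero, smul_zero]
  lyapunov_le := by
    have hscale : 0 < n * S.dTilde ^ 2 * ψ₅ * S.C ^ 2 := by
      have := hS.n_pos
      have := hS.dTilde_pos
      have := hcomp.C_pos
      positivity
    have hκν := (Real.sqrt_le_iff.1 ((le_max_left _ _).trans hs₀)).2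
    exact (lyapunov_zero_le_κν hgraph hPL hS hlam x₀).trans ((div_le_iff₀' hscale).1 hκν)
  lpNorm_le i := by
    have hsup : lpNorm S.p (x₀ i) ≤ ⨆ i, lpNorm S.p (x₀ i) :=
      le_ciSup (f := fun i => lpNorm S.p (x₀ i)) (Set.finite_range _).bddAbove i
    simp only [run, Pi.zero_apply, sub_zero]
    exact hsup.trans ((div_le_iff₀' hcomp.C_pos).1 ((le_max_right _ _).trans hs₀))

lemma invariant_run (hn : 2 ≤ n) (hcomp : S.LocallyBounded) (hgraph : S.UndirectedConnected)
    (hsmooth : S.Smooth) (hopt : S.FiniteOptimum) (hPL : S.PolyakLojasiewicz) (hS : S.Gains)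
    (hω : 0 ≤ S.ω) (hω' : S.ω ≤ 1 / S.r) {α ψ₅ : ℝ} (ha : S.Admissible α ψ₅) {lam : ℝ}
    (hlam : 0 < lam) {ε : ℝ} (hε : max (S.κ₉ α ψ₅) (S.κ₁₀ α ψ₅) < ε) {x₀ : Fin n → Vec d}
    {s₀ : ℝ} (hs₀ : 0 < s₀)
    (hs₀' : max (√(S.κν lam x₀ / (n * S.dTilde ^ 2 * ψ₅ * S.C ^ 2)))
      ((⨆ i, lpNorm S.p (x₀ i)) / S.C) ≤ s₀) (k : ℕ) :
    S.Invariant ψ₅ lam (s₀ * ε ^ k) (S.run α (fun k => s₀ * ε ^ k) x₀ k) := by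
  have hε₀ : 0 < ε := (le_max_of_le_left (Real.sqrt_nonneg _)).trans_lt hε
  induction k with
  | zero =>
    rw [pow_zero, mul_one]
    exact invariant_run_zero hcomp hgraph hPL hS (ha.ψ₅_pos hS) hlam hs₀' _ _
  | succ k ih =>
    rw [pow_succ, ← mul_assoc]
    exact ih.step hn hcomp hgraph hsmooth hopt hPL hS hω hω' ha hlam (by positivity) hε

lemma mul_gap (hn : (n : ℝ) ≠ 0) (x : Fin n → Vec d) :
    n * S.gap x = ‖kron d (centerMat n) (stack x)‖ ^ 2 + S.costGap (stack x) := by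
  have hcenter : ‖kron d (centerMat n) (stack x)‖ ^ 2 = ∑ i, ‖x i - avg x‖ ^ 2 := by
    simp only [kron_centerMat, PiLp.norm_sq_eq_of_L2, PiLp.sub_apply, kron_avgMat_apply]
  rw [hcenter, gap, costGap]
  field_simp
  ring

lemma gap_nonneg (hopt : S.FiniteOptimum) (x : Fin n → Vec d) : 0 ≤ S.gap x :=
  add_nonneg (sub_nonneg.2 (fStar_le hopt _)) (by positivity)

lemma Invariant.gap_le (hn : 2 ≤ n) (hgraph : S.UndirectedConnected) (hopt : S.FiniteOptimum)
    (hS : S.Gains) {ψ₅ lam s : ℝ} {z : State n d} (hz : S.Invariant ψ₅ lam s z) :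
    S.gap z.x ≤ S.dTilde ^ 2 * ψ₅ * S.C ^ 2 / S.ε₁ * s ^ 2 := by
  have hε₁ := hS.ε₁_pos
  have hcost : S.ε₁ * S.costGap (stack z.x) ≤ S.costGap (stack z.x) :=
    mul_le_of_le_one_left (costGap_nonneg hopt _) (hS.ε₁_le_half.trans (by norm_num))
  have henergy := mul_nonneg hε₁.le (dualEnergy_nonneg hn hgraph lam (stack z.x) (stack z.v))
  have hlyap : n * (S.ε₁ * S.gap z.x) ≤ n * (S.dTilde ^ 2 * ψ₅ * S.C ^ 2 * s ^ 2) := by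
    rw [mul_left_comm, mul_gap hS.n_pos.ne']
    linarith [(le_lyapunov hn hgraph hS lam _ _).trans hz.lyapunov_le]
  rw [div_mul_eq_mul_div, le_div_iff₀' hε₁]
  exact le_of_mul_le_mul_left hlyap hS.n_pos

lemma run_isBigO (hn : 2 ≤ n) (hcomp : S.LocallyBounded) (hgraph : S.UndirectedConnected)
    (hsmooth : S.Smooth) (hopt : S.FiniteOptimum) (hPL : S.PolyakLojasiewicz) (hS : S.Gains)
    (hω : 0 ≤ S.ω) (hω' : S.ω ≤ 1 / S.r) {α ψ₅ : ℝ} (ha : S.Admissible α ψ₅) {lam : ℝ}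
    (hlam : 0 < lam) {ε : ℝ} (hε : max (S.κ₉ α ψ₅) (S.κ₁₀ α ψ₅) < ε) {x₀ : Fin n → Vec d}
    {s₀ : ℝ} (hs₀ : 0 < s₀)
    (hs₀' : max (√(S.κν lam x₀ / (n * S.dTilde ^ 2 * ψ₅ * S.C ^ 2)))
      ((⨆ i, lpNorm S.p (x₀ i)) / S.C) ≤ s₀) :
    (fun k : ℕ => S.gap (S.run α (fun k => s₀ * ε ^ k) x₀ k).x)
      =O[Filter.atTop] (fun k : ℕ => ε ^ (2 * k)) := by
  refine Asymptotics.IsBigO.of_bound (S.dTilde ^ 2 * ψ₅ * S.C ^ 2 / S.ε₁ * s₀ ^ 2)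
    (Filter.Eventually.of_forall fun k => ?_)
  have hinv := invariant_run hn hcomp hgraph hsmooth hopt hPL hS hω hω' ha hlam hε hs₀ hs₀' k
  calc ‖S.gap (S.run α (fun k => s₀ * ε ^ k) x₀ k).x‖
      = S.gap (S.run α (fun k => s₀ * ε ^ k) x₀ k).x := Real.norm_of_nonneg (gap_nonneg hopt _)
    _ ≤ S.dTilde ^ 2 * ψ₅ * S.C ^ 2 / S.ε₁ * (s₀ * ε ^ k) ^ 2 := hinv.gap_le hn hgraph hopt hS
    _ = S.dTilde ^ 2 * ψ₅ * S.C ^ 2 / S.ε₁ * s₀ ^ 2 * ε ^ (2 * k) := by ring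
    _ ≤ S.dTilde ^ 2 * ψ₅ * S.C ^ 2 / S.ε₁ * s₀ ^ 2 * ‖ε ^ (2 * k)‖ := by
        rw [Real.norm_of_nonneg ((even_two_mul k).pow_nonneg ε)]

end Setting

end UnifiedCompression

end

theorem theorem3_general {n d : ℕ} (hn : 2 ≤ n) (hd : 1 ≤ d)
    (S : UnifiedCompression.Setting n d)
    (hcomp : S.LocallyBounded) (hgraph : S.UndirectedConnected) (hsmooth : S.Smooth)
    (hopt : S.FiniteOptimum) (hPL : S.PolyakLojasiewicz) (hω : 0 < S.ω) (hω' : S.ω ≤ 1 / S.r) :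
    (S.κ₁ < S.τ₁ → S.κ₂' < S.γ →
      ∃ ψ₅ αMax : ℝ, 0 < αMax ∧ ∀ α : ℝ, 0 < α → α < αMax → S.Admissible α ψ₅) ∧
    ∀ α ψ₅ : ℝ, S.Admissible α ψ₅ →
      max (S.κ₉ α ψ₅) (S.κ₁₀ α ψ₅) < 1 ∧
      ∀ (ε : ℝ), max (S.κ₉ α ψ₅) (S.κ₁₀ α ψ₅) < ε →
      ∀ (lam : ℝ), 0 < lam →
      ∀ (x₀ : Fin n → UnifiedCompression.Vec d) (s₀ : ℝ), 0 < s₀ →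
        max (√(S.κν lam x₀ / (n * S.dTilde ^ 2 * ψ₅ * S.C ^ 2)))
          ((⨆ i, UnifiedCompression.lpNorm S.p (x₀ i)) / S.C) ≤ s₀ →
        (fun k : ℕ => S.gap (S.run α (fun k => s₀ * ε ^ k) x₀ k).x)
          =O[Filter.atTop] (fun k : ℕ => ε ^ (2 * k)) := by
  have hreg := UnifiedCompression.Setting.regular hn hd hcomp hgraph hsmooth hPL hω hω'
  refine ⟨fun hτ hγ => ?_, fun α ψ₅ ha => ?_⟩
  · have hS := UnifiedCompression.Setting.gains_of_κ₂'_lt hreg hτ hγ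
    exact UnifiedCompression.Setting.exists_admissible hS
      (UnifiedCompression.Setting.φ₅_pos hS hγ)
  · have hS := ha.gains hreg
    exact ⟨max_lt (ha.κ₉_lt_one hS) (ha.κ₁₀_lt_one hS), fun ε hε lam hlam x₀ s₀ hs₀ hs₀' =>
      UnifiedCompression.Setting.run_isBigO hn hcomp hgraph hsmooth hopt hPL hS hω.le hω' ha hlam
        hε hs₀ hs₀'⟩

theorem theorem3 {n d : ℕ} (hn : 2 ≤ n) (hd : 1 ≤ d)
    (S : UnifiedCompression.Setting n d)
    (hcomp : S.LocallyBounded) (hgraph : S.UndirectedConnected) (hsmooth : S.Smooth)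
    (hopt : S.FiniteOptimum) (hPL : S.PolyakLojasiewicz)
    (hτ : S.κ₁ < S.τ₁) (hγ : S.κ₂ < S.γ) (hω : 0 < S.ω) (hω' : S.ω ≤ 1 / S.r) :
    (S.κ₂' < S.γ →
      ∃ ψ₅ αMax : ℝ, 0 < αMax ∧ ∀ α : ℝ, 0 < α → α < αMax → S.Admissible α ψ₅) ∧
    ∀ α ψ₅ : ℝ, S.Admissible α ψ₅ →
      max (S.κ₉ α ψ₅) (S.κ₁₀ α ψ₅) < 1 ∧
      ∀ (ε : ℝ), max (S.κ₉ α ψ₅) (S.κ₁₀ α ψ₅) < ε → ε < 1 →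
      ∀ (lam : ℝ), S.ρ₂ ≤ lam → lam ≤ S.ρ →
      ∀ (x₀ : Fin n → UnifiedCompression.Vec d) (s₀ : ℝ), 0 < s₀ →
        max (√(S.κν lam x₀ / (n * S.dTilde ^ 2 * ψ₅ * S.C ^ 2)))
          ((⨆ i, UnifiedCompression.lpNorm S.p (x₀ i)) / S.C) ≤ s₀ →
        (fun k : ℕ => S.gap (S.run α (fun k => s₀ * ε ^ k) x₀ k).x)
          =O[Filter.atTop] (fun k : ℕ => ε ^ (2 * k)) := by
  have h := theorem3_general hn hd S hcomp hgraph hsmooth hopt hPL hω hω'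
  exact ⟨h.1 hτ, fun α ψ₅ ha => ⟨(h.2 α ψ₅ ha).1, fun ε hε _ lam hlam _ =>
    (h.2 α ψ₅ ha).2 ε hε lam ((UnifiedCompression.Setting.ρ₂_pos hn hgraph).trans_le hlam)⟩⟩
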